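/- **Setting.** Let $\overline{\mathbf R_\flat}=\{s\in\mathbf R: s\ge 0\}\cup\{\flat_\sigma:\sigma>0\}$, ordered by the usual order on the reals, $\flat_{\sigma_1}<\flat_{\sigma_2}$ when $\sigma_1<\sigma_2$, and $x_1<\flat_\sigma<x_2$ for all real $0\le x_1<\frac12\le x_2$; so $s<\frac12$ means that $s\in[0,\frac12)$ is real or that $s=\flat_\sigma$ for some $\sigma>0$. For $\alpha\in\mathbf N^d$ let $h_\alpha(x)=\pi^{-d/4}(-1)^{|\alpha|}(2^{|\alpha|}\alpha!)^{-1/2}e^{|x|^2/2}\,\partial^\alpha e^{-|x|^2}$ be the Hermite functions on $\mathbf R^d$. Let $\mathcal H_0'(\mathbf R^d)$ be the space of all formal series $f=\sum_{\alpha\in\mathbf N^d}c(f,\alpha)h_\alpha$ with arbitrary $c(f,\alpha)\in\mathbf C$. A function $g\in L^2(\mathbf R^d)$ is identified with the series with coefficients $\int g\,h_\alpha\,dx$. The Roumieu Pilipović space $\mathcal H_s(\mathbf R^d)$ is the set of $f\in\mathcal H_0'(\mathbf R^d)$ such that $c(f,\cdot)$ has finite support, if $s=0$, and such that $c(f,\cdot)\,\vartheta_{r,s}\in\ell^p(\mathbf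 N^d)$ for some $r>0$, if $s\ne0$. Here $\vartheta_{r,s}(\alpha)=e^{r|\alpha|^{1/(2s)}}$ for real $s>0$, $\vartheta_{r,\flat_\sigma}(\alpha)=r^{|\alpha|}(\alpha!)^{1/(2\sigma)}$, and $p\in[1,\infty]$ is arbitrary but fixed. For $t\in\mathbf R^d$ the partial fractional Fourier transform $\mathscr F_t$ on $\mathcal H_0'(\mathbf R^d)$ is given by $c(\mathscr F_tf,\alpha)=e^{-i\frac\pi2\langle t,\alpha\rangle}c(f,\alpha)$. With $\langle x\rangle=(1+|x|^2)^{1/2}$ put $$\omega_{d,r,s}(x)=\begin{cases}e^{-r(\log\langle x\rangle)^{1/(1-2s)}},& s\in\mathbf R,\ 0\le s<\frac12,\\ e^{-r|x|^{2\sigma/(\sigma+1)}},& s=\flat_\sigma,\end{cases}\qquad x\in\mathbf R^d .$$ The norm $\|(\mathscr F_tf)\,e^{\frac12|\cdot|^2}\omega_{d,r,s}\|_{L^\infty}$ is understood to be $\infty$ when $\mathscr F_tf$ is not a function in $L^2(\mathbf R^d)$. **Theorem.** Let $s\in\overline{\mathbf R_\flat}$ with $s<\frac12$, $t_0\in\mathbf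 R^d$, $u\in(0,1)^d$ and $f\in\mathcal H_0'(\mathbf R^d)$. Put $\Lambda_{t_0,u}=\{t_0+(k_1u_1,\dots,k_du_d): k_j\in\mathbf Z,\ 0\le k_ju_j<2\}$. Then the following conditions are equivalent: 1. $f\in\mathcal H_s(\mathbf R^d)$; 2. for some $r>0$, $\displaystyle\sup_{t\in\Lambda_{t_0,u}}\big\|(\mathscr F_tf)\,e^{\frac12|\cdot|^2}\omega_{d,r,s}\big\|_{L^\infty}<\infty$; 3. for some $r>0$, $\displaystyle\sup_{t\in\mathbf R^d}\big\|(\mathscr F_tf)\,e^{\frac12|\cdot|^2}\omega_{d,r,s}\big\|_{L^\infty}<\infty$. -/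

import Mathlib

open MeasureTheory
open scoped ENNReal

noncomputable section

/-- The extended index set `ℝ₊ ∪ {♭_σ : σ > 0} ∪ {0}`. -/
inductive PilIndex : Type
  | real (s : ℝ) (hs : 0 ≤ s) : PilIndex
  | flat (σ : ℝ) (hσ : 0 < σ) : PilIndex

namespace PilIndex

/-- The strict order: the usual one on real indices, `♭_σ < ♭_τ` iff `σ < τ`, and every `♭_σ`
lies above all reals `< 1/2` and below all reals `≥ 1/2`. -/
protected def Lt : PilIndex → PilIndex → Prop
  | real a _, real b _ => a < b
  | real a _, flat _ _ => a < 1 / 2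
  | flat _ _, real b _ => 1 / 2 ≤ b
  | flat σ _, flat τ _ => σ < τ

instance : LT PilIndex := ⟨PilIndex.Lt⟩

/-- The real number `1/2` as an index. -/
def half : PilIndex := real (1 / 2) (by norm_num)

end PilIndex

/-- The length `|α|` of a multi-index. -/
def multiLength {d : ℕ} (α : Fin d → ℕ) : ℕ := ∑ j, α j

/-- The factorial `α!` of a multi-index. -/
def multiFactorial {d : ℕ} (α : Fin d → ℕ) : ℕ := ∏ j, (α j).factorial

/-- The weight `ϑ_{r,s}` on `ℕ^d`: `exp (r |α|^{1/(2s)})` for real `s > 0`, and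
`r^{|α|} (α!)^{1/(2σ)}` for `s = ♭_σ`. (Not used at the real index `0`.) -/
def seqWeight {d : ℕ} (r : ℝ) (s : PilIndex) (α : Fin d → ℕ) : ℝ :=
  match s with
  | .real s _ => Real.exp (r * (multiLength α : ℝ) ^ (1 / (2 * s)))
  | .flat σ _ => r ^ multiLength α * (multiFactorial α : ℝ) ^ (1 / (2 * σ))

/-- The weighted space `ℓ^p_{[ϑ]}(ℕ^d)`, as a set of sequences. -/
def weightedEll {d : ℕ} (p : ℝ≥0∞) (ϑ : (Fin d → ℕ) → ℝ) : Set ((Fin d → ℕ) → ℂ) :=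
  {c | Memℓp (fun α => c α * (ϑ α : ℂ)) p}

/-- The Roumieu sequence space `ℓ_s(ℕ^d)`: the finitely supported sequences if `s = 0`, and
otherwise the union over `r > 0` of the spaces `ℓ^p_{[ϑ_{r,s}]}(ℕ^d)`. -/
def roumieuEll (d : ℕ) (p : ℝ≥0∞) (s : PilIndex) : Set ((Fin d → ℕ) → ℂ) :=
  {c | (s = .real 0 le_rfl ∧ (Function.support c).Finite) ∨
    (s ≠ .real 0 le_rfl ∧ ∃ r : ℝ, 0 < r ∧ c ∈ weightedEll p (seqWeight r s))}

/-- The space `H₀'(ℝ^d)` of all formal Hermite series `∑ c(α) h_α`. -/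
@[ext]
structure FormalHermite (d : ℕ) : Type where
  /-- The Hermite coefficients `c(f, α)`. -/
  coeff : (Fin d → ℕ) → ℂ

/-- The Roumieu type Pilipović space `H_s(ℝ^d)`: the image of `ℓ_s(ℕ^d)` under the map that sends
a sequence to the formal Hermite series with these coefficients. -/
def pilipovicRoumieu (d : ℕ) (p : ℝ≥0∞) (s : PilIndex) : Set (FormalHermite d) :=
  FormalHermite.mk '' roumieuEll d p s

/-- The Hermite function of order `n` on the line. -/
def hermiteFun (n : ℕ) (x : ℝ) : ℝ :=
  Real.pi ^ (-(1 / 4) : ℝ) * (-1) ^ n * ((2 : ℝ) ^ n * n.factorial) ^ (-(1 / 2) : ℝ) *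
    Real.exp (x ^ 2 / 2) * iteratedDeriv n (fun y : ℝ => Real.exp (-y ^ 2)) x

/-- The Hermite function `h_α` on `ℝ^d`, as a tensor product. -/
def hermiteFunMulti {d : ℕ} (α : Fin d → ℕ) (x : EuclideanSpace ℝ (Fin d)) : ℝ :=
  ∏ j, hermiteFun (α j) (x j)

namespace FormalHermite

/-- The partial fractional Fourier transform `𝓕_t`, `t ∈ ℝ^d`, on formal Hermite series; it maps
`h_α` to `exp (-i (π/2) ⟨t, α⟩) h_α`. (For `t = (1, …, 1)` it is the Fourier transform.) -/
def fracFourier {d : ℕ} (t : Fin d → ℝ) (f : FormalHermite d) : FormalHermite d :=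
  ⟨fun α => Complex.exp (-(Complex.I * (Real.pi / 2 : ℝ) * ((∑ j, t j * α j : ℝ) : ℂ))) *
    f.coeff α⟩

/-- The formal series `f` is (the Hermite expansion of) the function `g ∈ L²(ℝ^d)`. -/
def Represents {d : ℕ} (f : FormalHermite d) (g : EuclideanSpace ℝ (Fin d) → ℂ) : Prop :=
  MemLp g 2 volume ∧ ∀ α, f.coeff α = ∫ x, g x * (hermiteFunMulti α x : ℂ)

/-- The norm `‖f · w‖_{L^∞}` in `[0, ∞]` of a formal Hermite series times a weight. The function
`g` below is determined up to null sets, so the infimum is over one value, or it is `∞` when `f` is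
not a function in `L²`. (For the weights `exp (|x|²/2) ω_{d,r,s}` with `s < 1/2`, every measurable
`g` with `g · w ∈ L^∞` is in `L²`.) -/
def weightedSupNorm {d : ℕ} (f : FormalHermite d) (w : EuclideanSpace ℝ (Fin d) → ℝ) : ℝ≥0∞ :=
  ⨅ (g : EuclideanSpace ℝ (Fin d) → ℂ) (_ : f.Represents g),
    eLpNorm (fun x => g x * (w x : ℂ)) ∞ volume

end FormalHermite

/-- The weight `ω_{d,r,s}`, with `⟨x⟩ = (1 + |x|²)^{1/2}`. (Meaningful for `s ≤ 1/2` only.) -/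
def omegaWeight (d : ℕ) (r : ℝ) (s : PilIndex) (x : EuclideanSpace ℝ (Fin d)) : ℝ :=
  match s with
  | .real s _ =>
    if s < 1 / 2 then Real.exp (-r * Real.log (√(1 + ‖x‖ ^ 2)) ^ (1 / (1 - 2 * s)))
    else Real.exp (-r * ‖x‖ ^ 2)
  | .flat σ _ => Real.exp (-r * ‖x‖ ^ (2 * σ / (σ + 1)))

/-- The finite lattice `Λ_{t₀,u}` of all `t₀ + (k₁u₁, …, k_d u_d)` with integers `k_j` such that
`0 ≤ k_j u_j < 2`. -/
def latticeSet {d : ℕ} (t₀ u : Fin d → ℝ) : Set (Fin d → ℝ) :=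
  {t | ∃ k : Fin d → ℤ, (∀ j, 0 ≤ k j * u j ∧ k j * u j < 2) ∧ ∀ j, t j = t₀ j + k j * u j}

end

noncomputable section

namespace HermiteAux

/-! The Bargmann transform turns the Hermite series `f` into the power series F(z) = ∑ c(f,α) z^α /
√α!, and it turns 𝓕_t into a rotation of each variable: the transform of 𝓕_t f at real x is F at the
points `ray (t j) * x j`. Write the weight ω as exp(-r V(|x|)), where V is either a power of log⟨x⟩
or |x|^ρ with ρ < 2; nearly all of the argument uses V only through `IsGrowth`.

From coefficients to functions (1 ⇒ 3): 𝓕_t leaves |c(f,α)| unchanged, so one bound serves all t.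
Cauchy's estimates give |h_n(y)| ≤ e^{-y²/2} e^{3n} (1 + |y|^n/√n!) (`abs_hermiteFun_le_pow`), and
the decay of the coefficients turns this growth into exp(r V(|y|)) with a geometric factor to spare
(`Damps`, `IsGrowth.exists_represents_of_damps`). The step 3 ⇒ 2 is restriction to fewer t.

From functions to coefficients (2 ⇒ 1): the Gaussian factor e^{-|y|²/2} of the bound on 𝓕_t f
combines with the Bargmann kernel into a translated Gaussian, so |F| ≤ A exp(r₁ V) on the rays
belonging to the lattice (`IsGrowth.exists_transform_bound`). As x has both signs and t runs through
a period of length 2, these rays cut the plane of each variable into sectors of opening at most πu/2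
< π/2. Bounded Hermite coefficients make F grow at most like exp(4|z|²), so the Phragmén–Lindelöf
principle fills the sectors, once V is replaced by the real part of a comparable holomorphic
function (`norm_le_on_sector`). Cauchy's estimates, one variable at a time (`CoeffBound.multi`),
then give |c(f,α)| ≤ A ∏ √α_j! exp(r₁ V(R_j)) / R_j^{α_j} for all R_j ≥ 1. The best R_j give the
decay that defines the sequence space (`radiusBound_log`, `radiusBound_rpow`,
`mem_roumieuEll_zero`). -/

theorem hasSum_of_eq {ι E : Type*} [AddCommMonoid E] [TopologicalSpace E] {f g : ι → E} {a b : E}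
    (h : HasSum f a) (hf : ∀ n, g n = f n) (hb : b = a) : HasSum g b := by
  rw [hb, show g = f from funext hf]; exact h

/-! ### Pointwise bounds for Hermite functions from Cauchy's estimates. -/

/-- The Gaussian as an entire function. -/
def cGauss (z : ℂ) : ℂ := Complex.exp (-z ^ 2)

theorem differentiable_cGauss : Differentiable ℂ cGauss := by
  unfold cGauss; fun_prop

theorem iteratedDeriv_gauss_ofReal (n : ℕ) (x : ℝ) :
    ((iteratedDeriv n (fun y : ℝ => Real.exp (-y ^ 2)) x : ℝ) : ℂ) = iteratedDeriv n cGauss x := by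
  have hs : ContDiff ℝ ⊤ (fun y : ℝ => Real.exp (-y ^ 2)) := by fun_prop
  have hc : ContDiff ℂ ⊤ cGauss := differentiable_cGauss.contDiff
  induction n generalizing x with
  | zero => simp [cGauss]
  | succ n ih =>
    rw [iteratedDeriv_succ, iteratedDeriv_succ]
    have h1 : HasDerivAt (iteratedDeriv n (fun y : ℝ => Real.exp (-y ^ 2)))
        (deriv (iteratedDeriv n (fun y : ℝ => Real.exp (-y ^ 2))) x) x :=
      ((hs.differentiable_iteratedDeriv n (by exact_mod_cast WithTop.coe_lt_top _)) x).hasDerivAt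
    have h2 : HasDerivAt (iteratedDeriv n cGauss) (deriv (iteratedDeriv n cGauss) x) (x : ℂ) :=
      ((hc.differentiable_iteratedDeriv n (by exact_mod_cast WithTop.coe_lt_top _)) x).hasDerivAt
    have h3 := h1.ofReal_comp
    have h4 := h2.comp_ofReal
    have : (fun y : ℝ => ((iteratedDeriv n (fun y : ℝ => Real.exp (-y ^ 2)) y : ℝ) : ℂ)) =
        fun y : ℝ => iteratedDeriv n cGauss y := funext ih
    rw [this] at h3
    exact h3.unique h4

theorem abs_iteratedDeriv_gauss_le (n : ℕ) (y : ℝ) {R : ℝ} (hR : 0 < R) :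
    |iteratedDeriv n (fun y : ℝ => Real.exp (-y ^ 2)) y| ≤
      n.factorial * (Real.exp (-y ^ 2 + 2 * |y| * R + R ^ 2)) / R ^ n := by
  have := Complex.norm_iteratedDeriv_le_of_forall_mem_sphere_norm_le (f := cGauss) (c := y)
    (C := Real.exp (-y ^ 2 + 2 * |y| * R + R ^ 2)) n hR
    differentiable_cGauss.diffContOnCl ?_
  · rw [← iteratedDeriv_gauss_ofReal, Complex.norm_real, Real.norm_eq_abs] at this
    exact this
  · intro z hz
    obtain ⟨v, rfl⟩ : ∃ v, z = y + v := ⟨z - y, by ring⟩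
    have hv : ‖v‖ = R := by simpa using hz
    rw [cGauss, Complex.norm_exp, Real.exp_le_exp]
    have e : -((y : ℂ) + v) ^ 2 = ((-y ^ 2 : ℝ) : ℂ) - ((2 * y : ℝ) : ℂ) * v - v ^ 2 := by
      push_cast; ring
    rw [e, Complex.sub_re, Complex.sub_re, Complex.ofReal_re, Complex.re_ofReal_mul]
    have h1 : |2 * y * v.re| ≤ 2 * |y| * R := by
      rw [abs_mul, abs_mul, abs_two, ← hv]
      exact mul_le_mul_of_nonneg_left (Complex.abs_re_le_norm v) (by positivity)
    have h2 : |(v ^ 2).re| ≤ R ^ 2 := by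
      rw [← hv, ← norm_pow]; exact Complex.abs_re_le_norm _
    have := neg_abs_le (2 * y * v.re)
    have := neg_abs_le ((v ^ 2).re)
    linarith

theorem hasSum_gauss_taylor (y x : ℝ) :
    HasSum (fun n : ℕ => x ^ n / n.factorial * iteratedDeriv n (fun y : ℝ => Real.exp (-y ^ 2)) y)
      (Real.exp (-(y + x) ^ 2)) := by
  have := Complex.hasSum_taylorSeries_of_entire differentiable_cGauss (y : ℂ) ((y + x : ℝ) : ℂ)
  rw [← Complex.hasSum_ofReal]
  refine hasSum_of_eq this (fun n => ?_) ?_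
  · rw [← iteratedDeriv_gauss_ofReal]
    simp
    ring
  · simp [cGauss]

theorem rpow_neg_half_factorial (n : ℕ) :
    ((2 : ℝ) ^ n * n.factorial) ^ (-(1 / 2) : ℝ) = (√2 ^ n * √n.factorial)⁻¹ := by
  rw [Real.rpow_neg (by positivity), ← Real.sqrt_eq_rpow, Real.sqrt_mul (by positivity)]
  congr 2
  rw [Real.sqrt_eq_iff_mul_self_eq (by positivity) (by positivity), ← mul_pow,
    Real.mul_self_sqrt (by norm_num)]

theorem pi_rpow_le_one : Real.pi ^ (-(1 / 4) : ℝ) ≤ 1 :=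
  Real.rpow_le_one_of_one_le_of_nonpos (by linarith [Real.pi_gt_three]) (by norm_num)

theorem hermiteFun_eq (n : ℕ) (x : ℝ) : hermiteFun n x =
    Real.pi ^ (-(1 / 4) : ℝ) * (-1) ^ n * (√2 ^ n * √n.factorial)⁻¹ * Real.exp (x ^ 2 / 2) *
      iteratedDeriv n (fun y : ℝ => Real.exp (-y ^ 2)) x := by
  rw [hermiteFun, rpow_neg_half_factorial]

/-- Cauchy's estimate for the Gaussian on the circle of radius R/√2 about y. The radius stays free
because different uses need different choices. -/
theorem abs_hermiteFun_le (n : ℕ) (y : ℝ) {R : ℝ} (hR : 0 < R) :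
    |hermiteFun n y| ≤ Real.exp (-(y ^ 2 / 2)) *
      (√n.factorial / R ^ n * Real.exp (√2 * |y| * R + R ^ 2 / 2)) := by
  have h2 : (0 : ℝ) < √2 := by positivity
  have hf : (0 : ℝ) < √n.factorial := by positivity
  have := abs_iteratedDeriv_gauss_le n y (R := R / √2) (by positivity)
  rw [hermiteFun_eq, abs_mul, abs_mul, abs_mul, abs_mul, abs_pow, abs_neg, abs_one, one_pow,
    mul_one, abs_of_pos (Real.exp_pos _), abs_of_pos (by positivity : 0 < Real.pi ^ (-(1 / 4) : ℝ)),
    abs_of_pos (by positivity : 0 < (√2 ^ n * √n.factorial)⁻¹)]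
  calc _ ≤ 1 * (√2 ^ n * √n.factorial)⁻¹ * Real.exp (y ^ 2 / 2) * (n.factorial *
      (Real.exp (-y ^ 2 + 2 * |y| * (R / √2) + (R / √2) ^ 2)) / (R / √2) ^ n) := by
        gcongr
        exact pi_rpow_le_one
    _ = _ := by
      have e1 : 2 * |y| * (R / √2) = √2 * |y| * R := by
        field_simp; rw [Real.sq_sqrt (by norm_num), mul_comm]
      have e2 : (R / √2) ^ 2 = R ^ 2 / 2 := by rw [div_pow, Real.sq_sqrt (by norm_num)]
      have e3 : (n.factorial : ℝ) = √n.factorial * √n.factorial :=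
        (Real.mul_self_sqrt (by positivity)).symm
      have e4 : Real.exp (y ^ 2 / 2) * Real.exp (-y ^ 2 + √2 * |y| * R + R ^ 2 / 2) =
          Real.exp (-(y ^ 2 / 2)) * Real.exp (√2 * |y| * R + R ^ 2 / 2) := by
        rw [← Real.exp_add, ← Real.exp_add]; ring_nf
      rw [e1, e2, div_pow]
      calc _ = (√2 ^ n * √n.factorial)⁻¹ * (n.factorial / (R ^ n / √2 ^ n)) *
            (Real.exp (y ^ 2 / 2) * Real.exp (-y ^ 2 + √2 * |y| * R + R ^ 2 / 2)) := by ring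
        _ = _ := by
          rw [e4]
          nth_rewrite 2 [e3]
          field_simp

/-- Nearly optimal radii in the Cauchy bound: R = √n while |y| ≤ √n, and R = n/|y| beyond. -/
theorem abs_hermiteFun_le_pow (n : ℕ) (y : ℝ) :
    |hermiteFun n y| ≤ Real.exp (-(y ^ 2 / 2)) *
      ((Real.exp 3) ^ n * (1 + |y| ^ n / √n.factorial)) := by
  rcases Nat.eq_zero_or_pos n with rfl | hn
  -- For n = 0 both radii degenerate to 0, so the Cauchy bound is used in the limit R → 0.
  · have hb : Filter.Tendsto (fun R : ℝ => Real.exp (-(y ^ 2 / 2)) *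
        (√(Nat.factorial 0) / R ^ 0 * Real.exp (√2 * |y| * R + R ^ 2 / 2)))
        (nhdsWithin 0 (Set.Ioi 0)) (nhds (Real.exp (-(y ^ 2 / 2)) * 1)) := by
      have : Continuous fun R : ℝ => Real.exp (-(y ^ 2 / 2)) *
        (√(Nat.factorial 0) / R ^ 0 * Real.exp (√2 * |y| * R + R ^ 2 / 2)) := by
        simp only [pow_zero, div_one]; fun_prop
      have := this.tendsto 0
      simp only [pow_zero, Nat.factorial_zero, Nat.cast_one, Real.sqrt_one, mul_zero] at this
      norm_num at this
      simpa using this.mono_left nhdsWithin_le_nhds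
    refine (ge_of_tendsto hb ?_).trans ?_
    · filter_upwards [self_mem_nhdsWithin] with R hR
      exact abs_hermiteFun_le 0 y hR
    · gcongr; simp
  have hn' : (0 : ℝ) < n := by exact_mod_cast hn
  have hf : (0 : ℝ) < √n.factorial := by positivity
  have hs2 : √2 ≤ 3 / 2 := by
    rw [Real.sqrt_le_left (by norm_num)]; norm_num
  have hfac : √n.factorial ≤ √n ^ n := by
    refine Real.sqrt_le_iff.mpr ⟨by positivity, ?_⟩
    rw [← pow_mul, mul_comm, pow_mul, Real.sq_sqrt hn'.le]
    exact_mod_cast n.factorial_le_pow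
  have hsq : √n ^ 2 = (n : ℝ) := Real.sq_sqrt hn'.le
  have hsp : 0 < √(n : ℝ) := by positivity
  rcases le_total (|y|) (√n) with h | h
  · refine (abs_hermiteFun_le n y hsp).trans ?_
    refine mul_le_mul_of_nonneg_left ?_ (Real.exp_pos _).le
    calc √n.factorial / √n ^ n * Real.exp (√2 * |y| * √n + √n ^ 2 / 2)
        ≤ 1 * Real.exp (3 * n) := by
          gcongr
          · rw [div_le_one (by positivity)]; exact hfac
          · have : √2 * |y| * √n ≤ 3 / 2 * √n * √n := by gcongr
            nlinarith
      _ = Real.exp 3 ^ n * 1 := by rw [← Real.exp_nat_mul]; ring_nf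
      _ ≤ _ := by gcongr; exact le_add_of_nonneg_right (by positivity)
  · have hy : 0 < |y| := hsp.trans_le h
    refine (abs_hermiteFun_le n y (R := n / |y|) (by positivity)).trans ?_
    refine mul_le_mul_of_nonneg_left ?_ (Real.exp_pos _).le
    have hny : (n : ℝ) ≤ |y| ^ 2 := by rw [← hsq]; gcongr
    calc √n.factorial / (n / |y|) ^ n * Real.exp (√2 * |y| * (n / |y|) + (n / |y|) ^ 2 / 2)
        ≤ |y| ^ n / √n.factorial * Real.exp (3 * n) := by
          refine mul_le_mul ?_ (Real.exp_le_exp.mpr ?_) (Real.exp_pos _).le (by positivity)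
          · rw [div_pow, div_div_eq_mul_div, div_le_div_iff₀ (by positivity) hf]
            have : √n.factorial * √n.factorial ≤ (n : ℝ) ^ n := by
              rw [Real.mul_self_sqrt (by positivity)]; exact_mod_cast n.factorial_le_pow
            nlinarith [pow_pos hy n]
          · have e : √2 * |y| * (n / |y|) = √2 * n := by field_simp
            have : (n / |y|) ^ 2 ≤ n := by
              rw [div_pow, div_le_iff₀ (by positivity)]; nlinarith
            rw [e]; nlinarith
      _ = Real.exp 3 ^ n * (|y| ^ n / √n.factorial) := by rw [← Real.exp_nat_mul]; ring_nf
      _ ≤ _ := by gcongr; exact le_add_of_nonneg_left zero_le_one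

theorem pow_div_sqrt_factorial_le (n : ℕ) {x : ℝ} (hx : 0 ≤ x) :
    x ^ n / √n.factorial ≤ 2 ^ n * Real.exp (x ^ 2 / 4) := by
  have h := Real.pow_div_factorial_le_exp (x := x ^ 2 / 2) (by positivity) n
  have : (x ^ n / √n.factorial) ^ 2 ≤ (2 ^ n * Real.exp (x ^ 2 / 4)) ^ 2 := by
    rw [div_pow, Real.sq_sqrt (by positivity), mul_pow, ← Real.exp_nat_mul]
    have e : (((2 : ℕ) : ℝ) * (x ^ 2 / 4)) = x ^ 2 / 2 := by push_cast; ring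
    rw [e]
    calc (x ^ n) ^ 2 / n.factorial = 2 ^ n * ((x ^ 2 / 2) ^ n / n.factorial) := by
          rw [div_pow]; field_simp; ring
      _ ≤ 2 ^ n * Real.exp (x ^ 2 / 2) := by gcongr
      _ ≤ _ := by
        gcongr; rw [← pow_mul]; exact pow_le_pow_right₀ (by norm_num) (by omega)
  exact (sq_le_sq₀ (by positivity) (by positivity)).mp this

/-! ### The Bargmann kernel as generating function of the Hermite functions. -/

/-- The kernel of the Bargmann transform, at real points. -/
def bargmannKernel (x y : ℝ) : ℝ :=
  Real.pi ^ (-(1 / 4) : ℝ) * Real.exp (-(x ^ 2 + y ^ 2) / 2 + √2 * x * y)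

theorem bargmannKernel_pos (x y : ℝ) : 0 < bargmannKernel x y := by
  unfold bargmannKernel; positivity

/-- This is the Taylor series of the Gaussian about y, evaluated at y - x/√2 and multiplied by
π^{-1/4} e^{y²/2}. -/
theorem hasSum_bargmannKernel (x y : ℝ) :
    HasSum (fun n : ℕ => hermiteFun n y * (x ^ n / √n.factorial)) (bargmannKernel x y) := by
  have h := (hasSum_gauss_taylor y (-x / √2)).mul_left
    (Real.pi ^ (-(1 / 4) : ℝ) * Real.exp (y ^ 2 / 2))
  refine hasSum_of_eq h (fun n => ?_) ?_
  · have e3 : (n.factorial : ℝ) = √n.factorial * √n.factorial :=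
      (Real.mul_self_sqrt (by positivity)).symm
    rw [hermiteFun_eq, e3, div_pow, neg_pow x]
    have : √2 ^ n ≠ 0 := by positivity
    have : √(n.factorial : ℝ) ≠ 0 := by positivity
    field_simp
    rw [Real.sqrt_sq (by positivity)]
  · rw [bargmannKernel, mul_assoc (Real.pi ^ _), ← Real.exp_add]
    congr 2
    have : √2 ^ 2 = 2 := Real.sq_sqrt (by norm_num)
    have e : -x / √2 = - (√2 * x / 2) := by field_simp; rw [this]
    rw [e]; linear_combination (x ^ 2 / 4) * this

/-! ### Orthonormality of the Hermite functions. -/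

open Polynomial

/-- The polynomial `p` with `D^n exp(-y²) = p(y) exp(-y²)`. -/
def gaussPoly : ℕ → ℝ[X]
  | 0 => 1
  | n + 1 => derivative (gaussPoly n) - 2 * X * gaussPoly n

theorem iteratedDeriv_gauss (n : ℕ) (x : ℝ) :
    iteratedDeriv n (fun y : ℝ => Real.exp (-y ^ 2)) x =
      (gaussPoly n).eval x * Real.exp (-x ^ 2) := by
  induction n generalizing x with
  | zero => simp [gaussPoly]
  | succ n ih =>
    rw [iteratedDeriv_succ, funext ih]
    have h1 : HasDerivAt (fun x : ℝ => Real.exp (-x ^ 2)) (Real.exp (-x ^ 2) * (-(2 * x))) x := by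
      have := (hasDerivAt_pow 2 x).neg.exp
      simpa using this
    have := ((gaussPoly n).hasDerivAt x).mul h1
    refine (HasDerivAt.deriv this).trans ?_
    simp [gaussPoly]
    ring

theorem natDegree_gaussPoly_le (n : ℕ) : (gaussPoly n).natDegree ≤ n := by
  induction n with
  | zero => simp [gaussPoly]
  | succ n ih =>
    rw [gaussPoly]
    refine (natDegree_sub_le _ _).trans (max_le ?_ ?_)
    · exact ((natDegree_derivative_le _).trans (by omega))
    · refine natDegree_mul_le.trans ?_
      have : (2 * X : ℝ[X]).natDegree ≤ 1 := by
        have : (2 * X : ℝ[X]) = C 2 * X := rfl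
        rw [this]; exact (natDegree_C_mul_le _ _).trans natDegree_X_le
      omega

theorem coeff_gaussPoly (n : ℕ) : (gaussPoly n).coeff n = (-2) ^ n := by
  induction n with
  | zero => simp [gaussPoly]
  | succ n ih =>
    have h1 : (derivative (gaussPoly n)).coeff (n + 1) = 0 :=
      coeff_eq_zero_of_natDegree_lt (lt_of_le_of_lt (natDegree_derivative_le _)
        (by have := natDegree_gaussPoly_le n; omega))
    have h2 : (2 * X * gaussPoly n : ℝ[X]) = C 2 * (gaussPoly n * X) := by
      rw [show (C 2 : ℝ[X]) = 2 from rfl]; ring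
    rw [gaussPoly, coeff_sub, h1, h2, coeff_C_mul, coeff_mul_X, ih]
    ring

theorem integrable_polynomial_mul_gauss (p : ℝ[X]) :
    Integrable fun x : ℝ => p.eval x * Real.exp (-x ^ 2) := by
  induction p using Polynomial.induction_on' with
  | add p q hp hq =>
    simp only [eval_add, add_mul]
    exact hp.add hq
  | monomial n a =>
    have := (integrable_rpow_mul_exp_neg_mul_sq (b := 1) one_pos (s := n)
      (by have := n.cast_nonneg (α := ℝ); linarith)).const_mul a
    simpa [mul_assoc] using this

/-- Integration by parts n times, all boundary terms vanishing. A polynomial of degree below n is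
therefore annihilated, which is the orthogonality. -/
theorem integral_polynomial_mul_iteratedDeriv_gauss (n : ℕ) (p : ℝ[X]) :
    ∫ x : ℝ, p.eval x * ((gaussPoly n).eval x * Real.exp (-x ^ 2)) =
      (-1) ^ n * ∫ x : ℝ, (derivative^[n] p).eval x * Real.exp (-x ^ 2) := by
  induction n generalizing p with
  | zero => simp [gaussPoly]
  | succ n ih =>
    have h := integral_mul_deriv_eq_deriv_mul_of_integrable
      (u := fun x : ℝ => p.eval x) (u' := fun x => (derivative p).eval x)
      (v := fun x : ℝ => (gaussPoly n).eval x * Real.exp (-x ^ 2))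
      (v' := fun x : ℝ => (gaussPoly (n + 1)).eval x * Real.exp (-x ^ 2))
      (fun x _ => p.hasDerivAt x) (fun x _ => ?_) ?_ ?_ ?_
    · rw [h, ih, Function.iterate_succ_apply, pow_succ]; ring
    · rw [← iteratedDeriv_gauss]
      have hs : ContDiff ℝ ⊤ (fun y : ℝ => Real.exp (-y ^ 2)) := by fun_prop
      rw [← funext (iteratedDeriv_gauss n), iteratedDeriv_succ]
      exact ((hs.differentiable_iteratedDeriv n
        (by exact_mod_cast WithTop.coe_lt_top _)) x).hasDerivAt
    · simpa [mul_assoc, Pi.mul_def] using integrable_polynomial_mul_gauss (p * gaussPoly (n + 1))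
    · simpa [mul_assoc, Pi.mul_def] using integrable_polynomial_mul_gauss (derivative p * gaussPoly n)
    · simpa [mul_assoc, Pi.mul_def] using integrable_polynomial_mul_gauss (p * gaussPoly n)

theorem hermiteFun_eq_gaussPoly (n : ℕ) (x : ℝ) : hermiteFun n x =
    Real.pi ^ (-(1 / 4) : ℝ) * (-1) ^ n * (√2 ^ n * √n.factorial)⁻¹ *
      ((gaussPoly n).eval x * Real.exp (-(x ^ 2 / 2))) := by
  rw [hermiteFun_eq, iteratedDeriv_gauss, mul_assoc, mul_left_comm (Real.exp _), ← Real.exp_add]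
  ring_nf

theorem continuous_hermiteFun (n : ℕ) : Continuous (hermiteFun n) := by
  rw [funext (hermiteFun_eq_gaussPoly n)]
  fun_prop

theorem hermiteFun_mul (m n : ℕ) (x : ℝ) : hermiteFun m x * hermiteFun n x =
    (Real.pi ^ (-(1 / 4) : ℝ) * (-1) ^ m * (√2 ^ m * √m.factorial)⁻¹) *
      (Real.pi ^ (-(1 / 4) : ℝ) * (-1) ^ n * (√2 ^ n * √n.factorial)⁻¹) *
      ((gaussPoly m).eval x * ((gaussPoly n).eval x * Real.exp (-x ^ 2))) := by
  rw [hermiteFun_eq_gaussPoly, hermiteFun_eq_gaussPoly]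
  have : Real.exp (-x ^ 2) = Real.exp (-(x ^ 2 / 2)) * Real.exp (-(x ^ 2 / 2)) := by
    rw [← Real.exp_add]; ring_nf
  rw [this]; ring

theorem integrable_hermiteFun_mul (m n : ℕ) :
    Integrable fun x : ℝ => hermiteFun m x * hermiteFun n x := by
  simp only [hermiteFun_mul]
  refine Integrable.const_mul ?_ _
  simpa [mul_assoc] using integrable_polynomial_mul_gauss (gaussPoly m * gaussPoly n)

theorem integral_hermiteFun_mul (m n : ℕ) :
    ∫ x : ℝ, hermiteFun m x * hermiteFun n x = if m = n then 1 else 0 := by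
  wlog h : m ≤ n generalizing m n
  · have := this n m (by omega)
    simp only [mul_comm (hermiteFun m _), this, eq_comm]
  simp only [hermiteFun_mul]
  rw [integral_const_mul, integral_polynomial_mul_iteratedDeriv_gauss]
  rcases h.lt_or_eq with h | rfl
  · rw [if_neg h.ne, iterate_derivative_eq_zero (lt_of_le_of_lt (natDegree_gaussPoly_le m) h)]
    simp
  · have hd : derivative^[m] (gaussPoly m) = C ((-2) ^ m * m.factorial : ℝ) := by
      have h0 : (derivative^[m] (gaussPoly m)).natDegree ≤ 0 :=
        (natDegree_iterate_derivative _ _).trans (by have := natDegree_gaussPoly_le m; omega)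
      rw [eq_C_of_natDegree_le_zero h0, coeff_iterate_derivative, zero_add, coeff_gaussPoly,
        Nat.descFactorial_self, nsmul_eq_mul, mul_comm]
    have hg : ∫ x : ℝ, Real.exp (-x ^ 2) = √Real.pi := by
      simpa using integral_gaussian 1
    have hp : Real.pi ^ (-(1 / 4) : ℝ) * Real.pi ^ (-(1 / 4) : ℝ) * √Real.pi = 1 := by
      rw [Real.sqrt_eq_rpow, ← Real.rpow_add Real.pi_pos, ← Real.rpow_add Real.pi_pos]
      norm_num
    have e3 : √(m.factorial : ℝ) ^ 2 = m.factorial := Real.sq_sqrt (by positivity)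
    have e4 : (√2 ^ m) ^ 2 = 2 ^ m := by
      rw [← pow_mul, mul_comm, pow_mul, Real.sq_sqrt (by norm_num)]
    have e5 : ((-1 : ℝ) ^ m) ^ 2 = 1 := by rw [← pow_mul, mul_comm, pow_mul]; norm_num
    have e6 : (-2 : ℝ) ^ m = (-1) ^ m * 2 ^ m := by rw [← mul_pow]; norm_num
    simp only [hd, eval_C, if_true, integral_const_mul, hg, e6]
    calc _ = (Real.pi ^ (-(1 / 4) : ℝ) * Real.pi ^ (-(1 / 4) : ℝ) * √Real.pi) *
          (((-1 : ℝ) ^ m) ^ 2 * ((-1 : ℝ) ^ m) ^ 2) *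
          ((2 ^ m * m.factorial) / ((√2 ^ m) ^ 2 * √(m.factorial : ℝ) ^ 2)) := by ring
      _ = 1 := by
        rw [hp, e5, e3, e4, div_self (by positivity)]; norm_num

/-! ### The class of admissible growth functions. -/

/-- The growth functions to which the Phragmén–Lindelöf argument applies: doubling, dominated by
every positive multiple of the square, and comparable to the real part of a holomorphic function
on the strips of width less than `π / 2` in the logarithmic coordinate. -/
structure IsGrowth (V : ℝ → ℝ) : Prop where
  zero : V 0 = 0
  nonneg : ∀ x, 0 ≤ x → 0 ≤ V x
  mono : MonotoneOn V (Set.Ici 0)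
  cont : Continuous fun x => V |x|
  doubling : ∃ D, 1 ≤ D ∧ ∀ x, 0 ≤ x → V (2 * x) ≤ D * V x
  subquad : ∀ ε, 0 < ε → ∃ C, 0 ≤ C ∧ ∀ x, 0 ≤ x → V x ≤ ε * x ^ 2 + C
  -- The strip |Im w| ≤ πu/4 is a sector of opening πu/2 in the variable e^w, which is the largest
  -- gap between neighbouring rays. The upper bound on ψ is asked only for radii e^{Re w} ≥ 1.
  sector : ∀ u ∈ Set.Ioo (0 : ℝ) 1, ∃ (ψ : ℂ → ℂ) (C : ℝ), 0 ≤ C ∧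
    (∀ w : ℂ, |w.im| ≤ Real.pi * u / 4 →
      DifferentiableAt ℂ ψ w ∧ V (Real.exp w.re) ≤ (ψ w).re) ∧
    ∀ w : ℂ, |w.im| ≤ Real.pi * u / 4 → 0 ≤ w.re → ‖ψ w‖ ≤ C * (1 + V (Real.exp w.re))

/-! ### Entire functions with Taylor coefficients of size 1/√n!. -/

theorem pow_div_sqrt_factorial_le_geometric (n : ℕ) {x : ℝ} (hx : 0 ≤ x) :
    x ^ n / √n.factorial ≤ Real.exp (4 * x ^ 2) * (1 / 2) ^ n := by
  -- At 4x the left side gains 4^n against 2^n on the right; the quotient is the geometric factor.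
  have h := pow_div_sqrt_factorial_le n (x := 4 * x) (by positivity)
  have e : (4 * x) ^ n / √n.factorial = 4 ^ n * (x ^ n / √n.factorial) := by
    rw [mul_pow]; ring
  have e2 : (4 * x) ^ 2 / 4 = 4 * x ^ 2 := by ring
  rw [e, e2] at h
  have e3 : (4 : ℝ) ^ n * (1 / 2) ^ n = 2 ^ n := by rw [← mul_pow]; norm_num
  have h4 : (0 : ℝ) < 4 ^ n := by positivity
  refine le_of_mul_le_mul_left (h.trans (le_of_eq ?_)) h4
  rw [← e3]; ring

section PowerSeries

variable {a : ℕ → ℂ} {M : ℝ}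

theorem norm_coeff_mul_pow_le (ha : ∀ n, ‖a n‖ ≤ M / √n.factorial) (z : ℂ) (n : ℕ) :
    ‖a n * z ^ n‖ ≤ M * Real.exp (4 * ‖z‖ ^ 2) * (1 / 2) ^ n := by
  have hM : 0 ≤ M := by simpa using (norm_nonneg _).trans (ha 0)
  rw [norm_mul, norm_pow]
  calc ‖a n‖ * ‖z‖ ^ n ≤ M / √n.factorial * ‖z‖ ^ n := by gcongr; exact ha n
    _ = M * (‖z‖ ^ n / √n.factorial) := by ring
    _ ≤ M * (Real.exp (4 * ‖z‖ ^ 2) * (1 / 2) ^ n) := by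
      gcongr; exact pow_div_sqrt_factorial_le_geometric n (norm_nonneg z)
    _ = _ := by ring

theorem norm_tsum_coeff_mul_pow_le (ha : ∀ n, ‖a n‖ ≤ M / √n.factorial) (z : ℂ) :
    ‖∑' n, a n * z ^ n‖ ≤ M * Real.exp (4 * ‖z‖ ^ 2) * 2 :=
  tsum_of_norm_bounded (hasSum_geometric_two.mul_left _) (norm_coeff_mul_pow_le ha z)

theorem hasFPowerSeriesOnBall_of_coeff_le (ha : ∀ n, ‖a n‖ ≤ M / √n.factorial) :
    HasFPowerSeriesOnBall (fun z : ℂ => ∑' n, a n * z ^ n)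
      (FormalMultilinearSeries.ofScalars ℂ a) 0 ⊤ := by
  have hr : (FormalMultilinearSeries.ofScalars ℂ a).radius = ⊤ := by
    refine ENNReal.eq_top_of_forall_nnreal_le fun r => ?_
    refine FormalMultilinearSeries.le_radius_of_bound _ (M * Real.exp (4 * (r : ℝ) ^ 2)) fun n => ?_
    have h := norm_coeff_mul_pow_le ha (r : ℂ) n
    have hM : 0 ≤ M := by simpa using (norm_nonneg _).trans (ha 0)
    rw [FormalMultilinearSeries.ofScalars_norm]
    have hr : ‖((r : ℝ) : ℂ)‖ = r := by simp
    rw [norm_mul, norm_pow, hr] at h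
    refine h.trans (mul_le_of_le_one_right (by positivity) ?_)
    exact pow_le_one₀ (by norm_num) (by norm_num)
  have h := (FormalMultilinearSeries.ofScalars ℂ a).hasFPowerSeriesOnBall (by rw [hr]; simp)
  rw [hr] at h
  convert h using 1
  ext z
  simp [FormalMultilinearSeries.sum, mul_comm]

theorem differentiable_tsum_coeff (ha : ∀ n, ‖a n‖ ≤ M / √n.factorial) :
    Differentiable ℂ fun z : ℂ => ∑' n, a n * z ^ n := by
  have := (hasFPowerSeriesOnBall_of_coeff_le ha).differentiableOn
  simpa [differentiableOn_univ] using this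

theorem norm_coeff_le_of_sphere (ha : ∀ n, ‖a n‖ ≤ M / √n.factorial) {R B : ℝ} (hR : 0 < R)
    (hB : ∀ z : ℂ, ‖z‖ = R → ‖∑' n, a n * z ^ n‖ ≤ B) (n : ℕ) : ‖a n‖ ≤ B / R ^ n := by
  have hd := differentiable_tsum_coeff ha
  have h1 := (hasFPowerSeriesOnBall_of_coeff_le ha).hasFPowerSeriesAt
  have h2 := h1.eq_formalMultilinearSeries h1.analyticAt.hasFPowerSeriesAt
  have h3 := congrFun (FormalMultilinearSeries.ofScalars_series_injective ℂ ℂ h2) n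
  have h4 := Complex.norm_iteratedDeriv_le_of_forall_mem_sphere_norm_le n hR
    (hd.diffContOnCl (s := Metric.ball 0 R)) (C := B) (fun z hz => hB z (by simpa using hz))
  rw [h3, norm_div, Complex.norm_natCast, div_le_iff₀ (by positivity)]
  refine h4.trans (le_of_eq ?_)
  ring

end PowerSeries

/-! ### Phragmén–Lindelöf between rays in one variable. -/

/-- The direction `exp (-i π t / 2)`. -/
def ray (t : ℝ) : ℂ := Complex.exp (-(Complex.I * (Real.pi / 2 : ℝ) * (t : ℝ)))

theorem ray_eq (t : ℝ) : ray t = Complex.exp (((-(Real.pi / 2 * t) : ℝ) : ℂ) * Complex.I) := by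
  rw [ray]; congr 1; push_cast; ring

theorem norm_ray (t : ℝ) : ‖ray t‖ = 1 := by
  rw [ray_eq, Complex.norm_exp_ofReal_mul_I]

theorem ray_add_two_mul_int (t : ℝ) (m : ℤ) : ray (t + 2 * m) = (-1) ^ m * ray t := by
  rw [ray, ray, ← Complex.exp_pi_mul_I, ← Complex.exp_int_mul, ← Complex.exp_add,
    Complex.exp_eq_exp_iff_exists_int]
  exact ⟨-m, by push_cast; ring⟩

/-- In the coordinate z = `ray μ` e^w about the bisector, the sector becomes a horizontal strip.
Multiplication by e^{-rψ} brings the boundary values below A because Re ψ ≥ V, and undoing it costs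
only ‖ψ‖ ≤ C(1 + V). The order-two bound with constant M is merely qualitative: M does not enter the
conclusion. -/
theorem norm_le_on_sector {V : ℝ → ℝ} {r u C : ℝ} (hr : 0 ≤ r) (hu : u < 1) {ψ : ℂ → ℂ}
    (hV : ∀ x, 0 ≤ x → 0 ≤ V x)
    (hψ : ∀ w : ℂ, |w.im| ≤ Real.pi * u / 4 →
      DifferentiableAt ℂ ψ w ∧ V (Real.exp w.re) ≤ (ψ w).re)
    (hψ' : ∀ w : ℂ, |w.im| ≤ Real.pi * u / 4 → 0 ≤ w.re → ‖ψ w‖ ≤ C * (1 + V (Real.exp w.re)))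
    {F : ℂ → ℂ} (hF : Differentiable ℂ F) {M A : ℝ} (hM : ∀ z, ‖F z‖ ≤ M * Real.exp (4 * ‖z‖ ^ 2))
    {τ₁ τ₂ : ℝ} (h12 : τ₁ < τ₂) (h12u : τ₂ - τ₁ ≤ u)
    (h1 : ∀ x : ℝ, 0 < x → ‖F (ray τ₁ * x)‖ ≤ A * Real.exp (r * V x))
    (h2 : ∀ x : ℝ, 0 < x → ‖F (ray τ₂ * x)‖ ≤ A * Real.exp (r * V x))
    {τ : ℝ} (hτ1 : τ₁ ≤ τ) (hτ2 : τ ≤ τ₂) {R : ℝ} (hR : 1 ≤ R) :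
    ‖F (ray τ * R)‖ ≤ A * Real.exp (r * (C * (1 + V R))) := by
  have hM0 : 0 ≤ M := by
    have := (norm_nonneg _).trans (hM 0); simpa using this
  set μ := (τ₁ + τ₂) / 2 with hμ
  set b := Real.pi * (τ₂ - τ₁) / 4 with hb
  have hπ := Real.pi_pos
  have hb0 : 0 < b := by rw [hb]; have : 0 < τ₂ - τ₁ := by linarith
                         positivity
  have hbu : b ≤ Real.pi * u / 4 := by rw [hb]; gcongr
  set H : ℂ → ℂ := fun w => F (ray μ * Complex.exp w) * Complex.exp (-(r * ψ w)) with hH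
  have hnorm : ∀ w : ℂ, |w.im| ≤ Real.pi * u / 4 → ‖H w‖ ≤
      ‖F (ray μ * Complex.exp w)‖ * Real.exp (-(r * V (Real.exp w.re))) := by
    intro w hw
    rw [hH, norm_mul, Complex.norm_exp, Complex.neg_re, Complex.re_ofReal_mul]
    gcongr
    exact (hψ w hw).2
  have hexp : ∀ w : ℂ, ray μ * Complex.exp w =
      ray (μ - 2 / Real.pi * w.im) * (Real.exp w.re : ℝ) := by
    intro w
    rw [ray, ray, Complex.ofReal_exp, ← Complex.exp_add, ← Complex.exp_add]
    congr 1
    conv_lhs => rw [← Complex.re_add_im w]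
    have : (Real.pi : ℂ) ≠ 0 := by exact_mod_cast hπ.ne'
    push_cast
    field_simp
    ring
  have key := fun z : ℂ => PhragmenLindelof.horizontal_strip (a := -b) (b := b) (C := A) (f := H)
    (z := z) ?_ ?_ ?_ ?_
  · have hz : ray τ * R = ray μ * Complex.exp ((Real.log R : ℝ) +
        ((Real.pi / 2 * (μ - τ) : ℝ) : ℂ) * Complex.I) := by
      rw [hexp]
      simp only [Complex.add_im, Complex.ofReal_im, Complex.mul_im, Complex.I_im, mul_one,
        Complex.ofReal_re, Complex.I_re, mul_zero, add_zero, zero_add, Complex.add_re,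
        Complex.mul_re, sub_zero, Real.exp_log (by linarith : 0 < R)]
      congr 2
      field_simp
      ring
    set w : ℂ := (Real.log R : ℝ) + ((Real.pi / 2 * (μ - τ) : ℝ) : ℂ) * Complex.I with hw
    have hwim : w.im = Real.pi / 2 * (μ - τ) := by simp [hw]
    have hwre : w.re = Real.log R := by simp [hw]
    have hl : -b ≤ w.im := by rw [hwim, hb, hμ]; nlinarith
    have hu' : w.im ≤ b := by rw [hwim, hb, hμ]; nlinarith
    have hwu : |w.im| ≤ Real.pi * u / 4 := (abs_le.mpr ⟨hl, hu'⟩).trans hbu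
    have hk := key w hl hu'
    have hF' : F (ray τ * R) = H w * Complex.exp (r * ψ w) := by
      rw [hz, hH]; simp only
      rw [mul_assoc, ← Complex.exp_add]; simp
    have hA : 0 ≤ A := (norm_nonneg _).trans hk
    rw [hF', norm_mul, Complex.norm_exp, Complex.re_ofReal_mul]
    gcongr
    refine (Complex.re_le_norm _).trans ?_
    have := hψ' w hwu (by rw [hwre]; exact Real.log_nonneg hR)
    rwa [hwre, Real.exp_log (by linarith : 0 < R)] at this
  · refine DifferentiableOn.diffContOnCl fun w hw => ?_
    have hw' : |w.im| ≤ Real.pi * u / 4 := by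
      have hcl : w ∈ Complex.im ⁻¹' Set.Icc (-b) b :=
        closure_minimal (Set.preimage_mono Set.Ioo_subset_Icc_self)
          (isClosed_Icc.preimage Complex.continuous_im) hw
      exact (abs_le.mpr hcl).trans hbu
    have h0 : DifferentiableAt ℂ (fun w => ray μ * Complex.exp w) w := by fun_prop
    have hd1 : DifferentiableAt ℂ (fun w => F (ray μ * Complex.exp w)) w :=
      DifferentiableAt.comp w (hF _) h0
    have hd2 : DifferentiableAt ℂ (fun w => Complex.exp (-(r * ψ w))) w :=
      (((hψ w hw').1).const_mul _).neg.cexp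
    exact (hd1.mul hd2).differentiableWithinAt
  -- The strip has width 2b ≤ πu/2 < π/2, so growth exp(B e^{c|Re w|}) is allowed for some c = 2 <
  -- π/(2b); the bound M exp(4|z|²) is of this kind with B = 4.
  · refine ⟨2, ?_, 4, ?_⟩
    · rw [lt_div_iff₀ (by linarith)]
      nlinarith
    · refine Asymptotics.IsBigO.of_bound M ?_
      refine Filter.eventually_inf_principal.mpr (Filter.Eventually.of_forall fun w hw => ?_)
      have hw' : |w.im| ≤ Real.pi * u / 4 := (abs_le.mpr ⟨hw.1.le, hw.2.le⟩).trans hbu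
      refine (hnorm w hw').trans ?_
      have h3 : Real.exp (-(r * V (Real.exp w.re))) ≤ 1 :=
        Real.exp_le_one_iff.mpr (by have := hV _ (Real.exp_pos w.re).le; nlinarith [mul_nonneg hr this])
      refine (mul_le_of_le_one_right (norm_nonneg _) h3).trans ((hM _).trans ?_)
      rw [Real.norm_eq_abs, abs_of_pos (Real.exp_pos _), norm_mul, norm_ray, one_mul,
        Complex.norm_exp, ← Real.exp_nat_mul]
      refine mul_le_mul_of_nonneg_left (Real.exp_le_exp.mpr (mul_le_mul_of_nonneg_left
        (Real.exp_le_exp.mpr ?_) (by norm_num))) hM0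
      push_cast
      linarith [le_abs_self w.re]
  · intro w hw
    refine (hnorm w (by rw [hw, abs_neg, abs_of_pos hb0]; exact hbu)).trans ?_
    have e : μ - 2 / Real.pi * w.im = τ₂ := by rw [hw, hμ, hb]; field_simp; ring
    rw [hexp, e]
    refine (mul_le_mul_of_nonneg_right (h2 _ (Real.exp_pos _)) (Real.exp_pos _).le).trans ?_
    rw [mul_assoc, ← Real.exp_add]; simp
  · intro w hw
    refine (hnorm w (by rw [hw, abs_of_pos hb0]; exact hbu)).trans ?_
    have e : μ - 2 / Real.pi * w.im = τ₁ := by rw [hw, hμ, hb]; field_simp; ring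
    rw [hexp, e]
    refine (mul_le_mul_of_nonneg_right (h1 _ (Real.exp_pos _)) (Real.exp_pos _).le).trans ?_
    rw [mul_assoc, ← Real.exp_add]; simp

/-- The lattice `{t₀ + k u : 0 ≤ k u < 2}` on the line. -/
def lineLattice (t₀ u : ℝ) : Set ℝ := {t | ∃ k : ℤ, (0 ≤ k * u ∧ k * u < 2) ∧ t = t₀ + k * u}

/-- The constants are independent of the centre t₀, the series and M, and the bound is linear in A.
This uniformity is what permits treating several variables one at a time. -/
theorem IsGrowth.exists_coeff_bound {V : ℝ → ℝ} (hV : IsGrowth V) {r : ℝ} (hr : 0 ≤ r) {u : ℝ}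
    (hu : u ∈ Set.Ioo (0 : ℝ) 1) :
    ∃ C r₁ : ℝ, 0 ≤ C ∧ 0 ≤ r₁ ∧ ∀ (t₀ : ℝ) (a : ℕ → ℂ) (M A : ℝ),
      (∀ n, ‖a n‖ ≤ M / √n.factorial) →
      (∀ t ∈ lineLattice t₀ u, ∀ x : ℝ, ‖∑' n, a n * (ray t * x) ^ n‖ ≤ A * Real.exp (r * V |x|)) →
      ∀ (n : ℕ) (R : ℝ), 1 ≤ R → ‖a n‖ ≤ A * (C * Real.exp (r₁ * V R) / R ^ n) := by
  obtain ⟨ψ, C, hC, hψ, hψ'⟩ := hV.sector u hu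
  refine ⟨Real.exp (r * C), r * C, by positivity, by positivity, fun t₀ a M A ha hA n R hR => ?_⟩
  set F : ℂ → ℂ := fun z => ∑' n, a n * z ^ n with hF
  have hd : Differentiable ℂ F := differentiable_tsum_coeff ha
  have hu0 := hu.1
  have hgrow : ∀ z, ‖F z‖ ≤ (M * 2) * Real.exp (4 * ‖z‖ ^ 2) := fun z =>
    (norm_tsum_coeff_mul_pow_le ha z).trans (le_of_eq (by ring))
  have hA' : ∀ t ∈ lineLattice t₀ u, ∀ x : ℝ, ‖F (ray t * x)‖ ≤ A * Real.exp (r * V |x|) := hA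
  -- The endpoint t₀ + 2 is never in the lattice, but its ray is the opposite of that of t₀ and x
  -- takes both signs.
  have hA2 : ∀ x : ℝ, ‖F (ray (t₀ + 2) * x)‖ ≤ A * Real.exp (r * V |x|) := by
    intro x
    have := hA' t₀ ⟨0, by simp, by simp⟩ (-x)
    have e := ray_add_two_mul_int t₀ 1
    simp only [Int.cast_one, mul_one, zpow_one, neg_mul, one_mul] at e
    rw [e]
    simpa using this
  have hball : ∀ z : ℂ, ‖z‖ = R → ‖F z‖ ≤ A * Real.exp (r * (C * (1 + V R))) := by
    intro z hz
    obtain ⟨τ, hτ⟩ : ∃ τ : ℝ, z = ray τ * R := by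
      refine ⟨-(2 / Real.pi * z.arg), ?_⟩
      rw [ray_eq, ← hz]
      have : -(Real.pi / 2 * -(2 / Real.pi * z.arg)) = z.arg := by
        have := Real.pi_pos.ne'; field_simp
      rw [this, mul_comm, Complex.norm_mul_exp_arg_mul_I]
    -- Reduce the direction modulo 2 to σ in [t₀, t₀ + 2), at the price of a sign, and let k index
    -- the last lattice point not beyond σ.
    set m : ℤ := ⌊(τ - t₀) / 2⌋
    have hm1 : (m : ℝ) ≤ (τ - t₀) / 2 := Int.floor_le _
    have hm2 : (τ - t₀) / 2 < m + 1 := Int.lt_floor_add_one _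
    set σ : ℝ := τ - 2 * m with hσ
    set k : ℤ := ⌊(σ - t₀) / u⌋
    have hk1 : (k : ℝ) * u ≤ σ - t₀ := by rw [← le_div_iff₀ hu0]; exact Int.floor_le _
    have hk2 : σ - t₀ < (k + 1) * u := by rw [← div_lt_iff₀ hu0]; exact Int.lt_floor_add_one _
    have hk0 : 0 ≤ (k : ℝ) := by
      exact_mod_cast Int.floor_nonneg.mpr (div_nonneg (by linarith) hu0.le)
    have hkm : t₀ + k * u ∈ lineLattice t₀ u := ⟨k, ⟨by positivity, by linarith⟩, rfl⟩
    obtain ⟨τ₂, h1, h2, h3, h4⟩ : ∃ τ₂, t₀ + k * u < τ₂ ∧ τ₂ - (t₀ + k * u) ≤ u ∧ σ ≤ τ₂ ∧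
        ∀ x : ℝ, ‖F (ray τ₂ * x)‖ ≤ A * Real.exp (r * V |x|) := by
      -- The ray on the other side of σ is the next lattice ray, or the ray of t₀ + 2 if the lattice
      -- has ended.
      rcases lt_or_ge ((k + 1 : ℝ) * u) 2 with h | h
      · refine ⟨t₀ + (k + 1) * u, by linarith, by linarith, by linarith, hA' _ ⟨k + 1, ?_, ?_⟩⟩
        · push_cast; exact ⟨by positivity, h⟩
        · push_cast; ring
      · exact ⟨t₀ + 2, by linarith, by linarith, by linarith, hA2⟩
    obtain ⟨δ, hδ, hδr⟩ : ∃ δ : ℝ, |δ| = 1 ∧ z = δ * (ray σ * R) := by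
      have e : τ = σ + 2 * m := by rw [hσ]; ring
      refine ⟨(-1) ^ m, by simp, ?_⟩
      rw [hτ, e, ray_add_two_mul_int]
      push_cast; ring
    have hd' : Differentiable ℂ fun z => F (δ * z) := by fun_prop
    have := norm_le_on_sector hr hu.2 hV.nonneg hψ hψ' hd' (M := M * 2) (A := A)
      (fun z => by simpa [hδ] using hgrow (δ * z)) h1 h2 (fun x hx => ?_) (fun x hx => ?_)
      (τ := σ) (by linarith) h3 hR
    · rwa [hδr]
    · have := hA' _ hkm (δ * x)
      rw [abs_mul, hδ, one_mul, abs_of_pos hx] at this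
      refine le_trans (le_of_eq ?_) this
      push_cast; ring_nf
    · have := h4 (δ * x)
      rw [abs_mul, hδ, one_mul, abs_of_pos hx] at this
      refine le_trans (le_of_eq ?_) this
      push_cast; ring_nf
  refine (norm_coeff_le_of_sphere ha (by linarith) hball n).trans (le_of_eq ?_)
  rw [← mul_div_assoc, ← Real.exp_add]
  ring_nf

/-! ### Coefficient bounds in several variables. -/

theorem summable_norm_pi_prod_and_hasSum {𝕜 : Type*} [NormedField 𝕜] [CompleteSpace 𝕜] {d : ℕ}
    (f : Fin d → ℕ → 𝕜) (hf : ∀ j, Summable fun n => ‖f j n‖) :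
    (Summable fun α : Fin d → ℕ => ‖∏ j, f j (α j)‖) ∧
      HasSum (fun α : Fin d → ℕ => ∏ j, f j (α j)) (∏ j, ∑' n, f j n) := by
  induction d with
  | zero =>
    refine ⟨(hasSum_fintype _).summable, ?_⟩
    simp
  | succ d ih =>
    obtain ⟨h1, h2⟩ := ih (fun j => f j.succ) (fun j => hf _)
    have hs := (hf 0).mul_norm h1
    have ht := tsum_mul_tsum_of_summable_norm (hf 0) h1
    have hsum := hs.of_norm.hasSum
    rw [← ht, h2.tsum_eq, ← Fin.prod_univ_succ (fun j => ∑' n, f j n)] at hsum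
    constructor
    · rw [← (Fin.consEquiv fun _ => ℕ).summable_iff]
      refine hs.congr fun p => ?_
      simp [Fin.consEquiv, Fin.prod_univ_succ]
    · rw [← (Fin.consEquiv fun _ => ℕ).hasSum_iff]
      refine hasSum_of_eq hsum (fun p => ?_) rfl
      simp [Fin.consEquiv, Fin.prod_univ_succ]

/-- The conclusion of the one-dimensional Phragmén–Lindelöf argument for the lattice spacing `u`. -/
def CoeffBound (V : ℝ → ℝ) (r C r₁ u : ℝ) : Prop :=
  ∀ (t₀ : ℝ) (a : ℕ → ℂ) (M A : ℝ), (∀ n, ‖a n‖ ≤ M / √n.factorial) →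
    (∀ t ∈ lineLattice t₀ u, ∀ x : ℝ, ‖∑' n, a n * (ray t * x) ^ n‖ ≤ A * Real.exp (r * V |x|)) →
    ∀ (n : ℕ) (R : ℝ), 1 ≤ R → ‖a n‖ ≤ A * (C * Real.exp (r₁ * V R) / R ^ n)

theorem CoeffBound.mono {V : ℝ → ℝ} (hV : IsGrowth V) {r C r₁ C' r₁' u : ℝ} (hC : 0 ≤ C)
    (h : CoeffBound V r C r₁ u) (hCC' : C ≤ C') (hr : r₁ ≤ r₁') : CoeffBound V r C' r₁' u := by
  intro t₀ a M A ha hA n R hR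
  have hA0 : 0 ≤ A := by
    have := (norm_nonneg _).trans (hA t₀ ⟨0, by simp, by simp⟩ 0)
    exact nonneg_of_mul_nonneg_left this (Real.exp_pos _)
  have := hV.nonneg R (by linarith)
  have := hC.trans hCC'
  refine (h t₀ a M A ha hA n R hR).trans ?_
  gcongr

theorem summable_multi_power {d : ℕ} (z : Fin d → ℂ) :
    Summable fun α : Fin d → ℕ => ∏ j, (‖z j‖ ^ α j / √(α j).factorial) := by
  refine ((summable_norm_pi_prod_and_hasSum (𝕜 := ℝ)
    (fun j n => ‖z j‖ ^ n / √n.factorial) fun j => ?_).2).summable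
  refine Summable.of_nonneg_of_le (fun n => norm_nonneg _) (fun n => ?_)
    (summable_geometric_two.mul_left (Real.exp (4 * ‖z j‖ ^ 2)))
  rw [Real.norm_of_nonneg (by positivity)]
  exact pow_div_sqrt_factorial_le_geometric n (norm_nonneg _)

theorem norm_multi_term_le {d : ℕ} {c : (Fin d → ℕ) → ℂ} {M : ℝ}
    (hc : ∀ α, ‖c α‖ ≤ M / ∏ j, √(α j).factorial) (z : Fin d → ℂ) (α : Fin d → ℕ) :
    ‖c α * ∏ j, z j ^ α j‖ ≤ M * ∏ j, (‖z j‖ ^ α j / √(α j).factorial) := by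
  rw [norm_mul, norm_prod, Finset.prod_div_distrib]
  simp only [norm_pow]
  calc _ ≤ M / (∏ j, √(α j).factorial) * ∏ j, ‖z j‖ ^ α j := by
        gcongr; exact hc α
    _ = _ := by ring

theorem tsum_fin_cons {d : ℕ} {f : (Fin (d + 1) → ℕ) → ℂ} (hf : Summable f) :
    ∑' γ, f γ = ∑' n : ℕ, ∑' β : Fin d → ℕ, f (Fin.cons n β) := by
  have h : Summable fun p : ℕ × (Fin d → ℕ) => f (Fin.cons p.1 p.2) :=
    (Fin.consEquiv fun _ : Fin (d + 1) => ℕ).summable_iff.mpr hf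
  rw [← h.tsum_prod]
  exact ((Fin.consEquiv fun _ : Fin (d + 1) => ℕ).tsum_eq f).symm

/-- Induction on the dimension. With the last d variables fixed on their rays, the power series in
the first variable obeys the one-variable bound. Its coefficient of index `α 0` is a power series in
the other variables, to which the induction hypothesis applies with that bound absorbed into A. -/
theorem CoeffBound.multi {V : ℝ → ℝ} {r C r₁ : ℝ} {d : ℕ} (u : Fin d → ℝ)
    (h : ∀ j, CoeffBound V r C r₁ (u j)) (t₀ : Fin d → ℝ) (c : (Fin d → ℕ) → ℂ) (M A : ℝ)
    (hc : ∀ α, ‖c α‖ ≤ M / ∏ j, √(α j).factorial)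
    (hA : ∀ t : Fin d → ℝ, (∀ j, t j ∈ lineLattice (t₀ j) (u j)) → ∀ x : Fin d → ℝ,
      ‖∑' α, c α * ∏ j, (ray (t j) * x j) ^ α j‖ ≤ A * ∏ j, Real.exp (r * V |x j|))
    (α : Fin d → ℕ) (R : Fin d → ℝ) (hR : ∀ j, 1 ≤ R j) :
    ‖c α‖ ≤ A * ∏ j, (C * Real.exp (r₁ * V (R j)) / R j ^ α j) := by
  induction d generalizing A M with
  | zero =>
    have := hA t₀ (fun j => j.elim0) 0
    rw [tsum_eq_single α (fun b hb => (hb (Subsingleton.elim _ _)).elim)] at this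
    simpa using this
  | succ d ih =>
    have hM : 0 ≤ M := by simpa using (norm_nonneg _).trans (hc 0)
    have hslice : ∀ (n : ℕ) (β : Fin d → ℕ),
        ‖c (Fin.cons n β)‖ ≤ (M / √n.factorial) / ∏ j, √(β j).factorial := by
      intro n β
      refine (hc _).trans (le_of_eq ?_)
      rw [Fin.prod_univ_succ]; simp [div_div]
    have key := ih (fun j => u j.succ) (fun j => h _) (fun j => t₀ j.succ)
      (fun β => c (Fin.cons (α 0) β)) (M / √(α 0).factorial)
      (A * (C * Real.exp (r₁ * V (R 0)) / R 0 ^ α 0)) (hslice _) (fun t ht x => ?_)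
      (fun j => α j.succ) (fun j => R j.succ) (fun j => hR _)
    · have e : (Fin.cons (α 0) fun j => α j.succ : Fin (d + 1) → ℕ) = α := Fin.cons_self_tail α
      rw [e] at key
      rw [Fin.prod_univ_succ, ← mul_assoc]
      exact key
    · set S := ∑' β : Fin d → ℕ, ∏ j, (‖ray (t j) * x j‖ ^ β j / √(β j).factorial) with hS
      have hsS := (summable_multi_power fun j => ray (t j) * x j).hasSum
      have h1 := h 0 (t₀ 0) (fun n => ∑' β : Fin d → ℕ, c (Fin.cons n β) *
        ∏ j, (ray (t j) * x j) ^ β j) (M * S) (A * ∏ j, Real.exp (r * V |x j|))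
        (fun n => ?_) (fun s hs y => ?_) (α 0) (R 0) (hR 0)
      · exact h1.trans (le_of_eq (by ring))
      · refine (tsum_of_norm_bounded (hsS.mul_left _)
          (norm_multi_term_le (hslice n) fun j => ray (t j) * x j)).trans (le_of_eq ?_)
        rw [hS]; ring
      · have hfull := hA (Fin.cons s t) (fun j => ?_) (Fin.cons y x)
        · have hsum : Summable fun γ : Fin (d + 1) → ℕ => c γ *
              ∏ j, (ray ((Fin.cons s t : Fin (d + 1) → ℝ) j) *
                ((Fin.cons y x : Fin (d + 1) → ℝ) j)) ^ γ j :=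
            Summable.of_norm_bounded ((summable_multi_power _).mul_left M)
              (norm_multi_term_le hc _)
          rw [tsum_fin_cons hsum] at hfull
          refine le_trans (le_of_eq ?_) (hfull.trans (le_of_eq ?_))
          · congr 1
            refine tsum_congr fun n => ?_
            rw [← tsum_mul_right]
            refine tsum_congr fun β => ?_
            simp only [Fin.prod_univ_succ, Fin.cons_zero, Fin.cons_succ]
            ring
          · simp only [Fin.prod_univ_succ, Fin.cons_zero, Fin.cons_succ]
            ring
        · refine Fin.cases ?_ (fun i => ?_) j
          · simpa using hs
          · simpa using ht i

theorem IsGrowth.exists_coeffBound_forall {V : ℝ → ℝ} (hV : IsGrowth V) {r : ℝ} (hr : 0 ≤ r) {d : ℕ}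
    {u : Fin d → ℝ} (hu : ∀ j, u j ∈ Set.Ioo (0 : ℝ) 1) :
    ∃ C r₁ : ℝ, 0 ≤ C ∧ 0 ≤ r₁ ∧ ∀ j, CoeffBound V r C r₁ (u j) := by
  choose C r₁ hC hr₁ h using fun j => hV.exists_coeff_bound hr (hu j)
  refine ⟨∑ j, C j, ∑ j, r₁ j, Finset.sum_nonneg fun j _ => hC j,
    Finset.sum_nonneg fun j _ => hr₁ j, fun j => ?_⟩
  exact CoeffBound.mono hV (hC j) (h j)
    (Finset.single_le_sum (fun i _ => hC i) (Finset.mem_univ j))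
    (Finset.single_le_sum (fun i _ => hr₁ i) (Finset.mem_univ j))

/-! ### Tensor products and integrals on Euclidean space. -/

section Euclidean

variable {𝕜 : Type*} [RCLike 𝕜] {d : ℕ}

theorem integrable_euclidean_prod {f : Fin d → ℝ → 𝕜} (hf : ∀ j, Integrable (f j)) :
    Integrable fun x : EuclideanSpace ℝ (Fin d) => ∏ j, f j (x j) := by
  have h := Integrable.fintype_prod hf
  have e := EuclideanSpace.volume_preserving_symm_measurableEquiv_toLp (Fin d)
  exact e.integrable_comp_of_integrable h

theorem integral_euclidean_prod (f : Fin d → ℝ → 𝕜) :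
    ∫ x : EuclideanSpace ℝ (Fin d), ∏ j, f j (x j) = ∏ j, ∫ y, f j y := by
  have e := EuclideanSpace.volume_preserving_symm_measurableEquiv_toLp (Fin d)
  rw [← integral_fintype_prod_volume_eq_prod]
  exact e.integral_comp (MeasurableEquiv.measurableEmbedding _) (fun y => ∏ j, f j (y j))

theorem integrable_hermiteFunMulti_mul (α β : Fin d → ℕ) :
    Integrable fun x : EuclideanSpace ℝ (Fin d) => hermiteFunMulti α x * hermiteFunMulti β x := by
  simp only [hermiteFunMulti, ← Finset.prod_mul_distrib]
  exact integrable_euclidean_prod (f := fun j y => hermiteFun (α j) y * hermiteFun (β j) y)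
    fun j => integrable_hermiteFun_mul _ _

theorem integral_hermiteFunMulti_mul (α β : Fin d → ℕ) :
    ∫ x : EuclideanSpace ℝ (Fin d), hermiteFunMulti α x * hermiteFunMulti β x =
      if α = β then 1 else 0 := by
  simp only [hermiteFunMulti, ← Finset.prod_mul_distrib]
  rw [integral_euclidean_prod fun j y => hermiteFun (α j) y * hermiteFun (β j) y]
  simp only [integral_hermiteFun_mul]
  split_ifs with h
  · simp [h]
  · obtain ⟨j, hj⟩ := Function.ne_iff.mp h
    exact Finset.prod_eq_zero (Finset.mem_univ j) (if_neg hj)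

theorem continuous_hermiteFunMulti (α : Fin d → ℕ) :
    Continuous (hermiteFunMulti α : EuclideanSpace ℝ (Fin d) → ℝ) := by
  unfold hermiteFunMulti
  have := fun n => continuous_hermiteFun n
  fun_prop

end Euclidean

/-! ### Consequences of the growth axioms and the Bargmann integral. -/

namespace IsGrowth

variable {V : ℝ → ℝ}

theorem add_le (hV : IsGrowth V) : ∃ D, 1 ≤ D ∧ ∀ x y, 0 ≤ x → 0 ≤ y → V (x + y) ≤ D * (V x + V y) := by
  obtain ⟨D, hD, h⟩ := hV.doubling
  refine ⟨D, hD, fun x y hx hy => ?_⟩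
  wlog hxy : x ≤ y generalizing x y
  · rw [add_comm, add_comm (V x)]; exact this y x hy hx (le_of_not_ge hxy)
  have h1 : V (x + y) ≤ V (2 * y) :=
    hV.mono (Set.mem_Ici.mpr (by positivity)) (Set.mem_Ici.mpr (by positivity)) (by linarith)
  have := hV.nonneg x hx
  nlinarith [h y hy]

theorem sum_le (hV : IsGrowth V) {ι : Type*} (s : Finset ι) :
    ∃ D, 0 ≤ D ∧ ∀ a : ι → ℝ, (∀ j, 0 ≤ a j) → V (∑ j ∈ s, a j) ≤ D * ∑ j ∈ s, V (a j) := by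
  classical
  induction s using Finset.induction_on with
  | empty => exact ⟨0, le_rfl, fun a _ => by simp [hV.zero]⟩
  | insert i s hi ih =>
    obtain ⟨D, hD, h⟩ := ih
    obtain ⟨D', hD', h'⟩ := hV.add_le
    refine ⟨D' * (D + 1), by positivity, fun a ha => ?_⟩
    rw [Finset.sum_insert hi, Finset.sum_insert hi]
    have h1 := h' (a i) (∑ j ∈ s, a j) (ha i) (Finset.sum_nonneg fun j _ => ha j)
    have h2 := h a ha
    have h3 := hV.nonneg _ (ha i)
    have h4 : 0 ≤ ∑ j ∈ s, V (a j) := Finset.sum_nonneg fun j _ => hV.nonneg _ (ha j)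
    calc _ ≤ D' * (V (a i) + D * ∑ j ∈ s, V (a j)) := h1.trans (by gcongr)
      _ ≤ D' * ((D + 1) * V (a i) + (D + 1) * ∑ j ∈ s, V (a j)) := by
        gcongr
        · nlinarith
        · linarith
      _ = _ := by ring

theorem euclidean_norm_le_sum {d : ℕ} (x : EuclideanSpace ℝ (Fin d)) : ‖x‖ ≤ ∑ j, |x j| := by
  have h := EuclideanSpace.basisFun (Fin d) ℝ |>.sum_repr x
  calc ‖x‖ = ‖∑ j, (EuclideanSpace.basisFun (Fin d) ℝ).repr x j •
        EuclideanSpace.basisFun (Fin d) ℝ j‖ := by rw [h]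
    _ ≤ ∑ j, ‖(EuclideanSpace.basisFun (Fin d) ℝ).repr x j •
        EuclideanSpace.basisFun (Fin d) ℝ j‖ := norm_sum_le _ _
    _ = _ := by simp [norm_smul]

theorem norm_le_sum (hV : IsGrowth V) (d : ℕ) : ∃ D, 0 ≤ D ∧
    ∀ x : EuclideanSpace ℝ (Fin d), V ‖x‖ ≤ D * ∑ j, V |x j| := by
  obtain ⟨D, hD, h⟩ := hV.sum_le (Finset.univ : Finset (Fin d))
  refine ⟨D, hD, fun x => (hV.mono (norm_nonneg x) ?_ (euclidean_norm_le_sum x)).trans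
    (h _ fun j => abs_nonneg _)⟩
  exact Set.mem_Ici.mpr (Finset.sum_nonneg fun j _ => abs_nonneg _)

theorem integrable_gauss (hV : IsGrowth V) {r : ℝ} (hr : 0 ≤ r) (b : ℝ) :
    Integrable fun y : ℝ => Real.exp (-y ^ 2 + r * V |y| + b * |y|) := by
  -- With this ε the term r V takes at most y²/4, and b|y| ≤ y²/4 + b², so half of the Gaussian
  -- survives.
  obtain ⟨C, hC, h⟩ := hV.subquad (1 / (4 * (r + 1))) (by positivity)
  have hi := (integrable_exp_neg_mul_sq (b := 1 / 2) (by norm_num)).const_mul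
    (Real.exp (r * C + b ^ 2))
  refine hi.mono' ?_ (Filter.Eventually.of_forall fun y => ?_)
  · obtain ⟨W, hW, hWV⟩ : ∃ W : ℝ → ℝ, Continuous W ∧ ∀ y, V |y| = W y := ⟨_, hV.cont, fun _ => rfl⟩
    simp only [hWV]
    exact Continuous.aestronglyMeasurable (by fun_prop)
  · rw [Real.norm_of_nonneg (Real.exp_pos _).le, ← Real.exp_add, Real.exp_le_exp]
    have h1 := mul_le_mul_of_nonneg_left (h |y| (abs_nonneg y)) hr
    rw [sq_abs] at h1
    have h2 : r * (1 / (4 * (r + 1)) * y ^ 2 + C) ≤ 1 / 4 * y ^ 2 + r * C := by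
      have : r * (1 / (4 * (r + 1))) ≤ 1 / 4 := by
        rw [mul_one_div, div_le_div_iff₀ (by positivity) (by norm_num)]; linarith
      nlinarith [sq_nonneg y]
    nlinarith [sq_nonneg (|y| / 2 - b), sq_abs y]

/-- Completing the square: e^{-y²/2} times the kernel is at most a Gaussian centred at x/√2, with no
exponential factor in x left over. Doubling splits V(|y|) between |y - x/√2| and |x|, and
translation invariance does the rest. -/
theorem bargmann_bound (hV : IsGrowth V) {r : ℝ} (hr : 0 ≤ r) :
    ∃ C r₁ : ℝ, 0 ≤ C ∧ 0 ≤ r₁ ∧ ∀ x : ℝ,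
      Integrable (fun y : ℝ => Real.exp (-(y ^ 2 / 2) + r * V |y|) * bargmannKernel x y) ∧
      ∫ y : ℝ, Real.exp (-(y ^ 2 / 2) + r * V |y|) * bargmannKernel x y ≤
        C * Real.exp (r₁ * V |x|) := by
  obtain ⟨D, hD, h⟩ := hV.add_le
  have hi := hV.integrable_gauss (r := r * D) (by positivity) 0
  set I := ∫ v : ℝ, Real.exp (-v ^ 2 + r * D * V |v| + 0 * |v|) with hI
  refine ⟨I, r * D, integral_nonneg fun v => (Real.exp_pos _).le, by positivity, fun x => ?_⟩
  have hs2 : √2 ^ 2 = 2 := Real.sq_sqrt (by norm_num)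
  have hb : ∀ y : ℝ, Real.exp (-(y ^ 2 / 2) + r * V |y|) * bargmannKernel x y ≤
      Real.exp (r * D * V |x|) *
        Real.exp (-(y - √2 / 2 * x) ^ 2 + r * D * V |y - √2 / 2 * x| + 0 * |y - √2 / 2 * x|) := by
    intro y
    have h1 : V |y| ≤ D * (V |y - √2 / 2 * x| + V |x|) := by
      refine (hV.mono (abs_nonneg y) (Set.mem_Ici.mpr (by positivity)) ?_).trans
        (h _ _ (abs_nonneg _) (abs_nonneg _))
      have h3 : √2 / 2 ≤ 1 := by nlinarith [Real.sqrt_nonneg 2]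
      calc |y| = |(y - √2 / 2 * x) + √2 / 2 * x| := by ring_nf
        _ ≤ |y - √2 / 2 * x| + |√2 / 2 * x| := abs_add_le _ _
        _ ≤ _ := by
          refine add_le_add_right ?_ _
          rw [abs_mul, abs_of_nonneg (by positivity : (0 : ℝ) ≤ √2 / 2)]
          exact mul_le_of_le_one_left (abs_nonneg x) h3
    rw [bargmannKernel, mul_left_comm, ← Real.exp_add, ← Real.exp_add]
    refine (mul_le_of_le_one_left (Real.exp_pos _).le pi_rpow_le_one).trans ?_
    rw [Real.exp_le_exp]
    have e : -(y ^ 2 / 2) + (-(x ^ 2 + y ^ 2) / 2 + √2 * x * y) = -(y - √2 / 2 * x) ^ 2 := by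
      linear_combination (x ^ 2 / 4) * hs2
    nlinarith [mul_le_mul_of_nonneg_left h1 hr]
  have hi' := (hi.comp_sub_right (√2 / 2 * x)).const_mul (Real.exp (r * D * V |x|))
  have hint : Integrable (fun y : ℝ =>
      Real.exp (-(y ^ 2 / 2) + r * V |y|) * bargmannKernel x y) := by
    refine hi'.mono' ?_ (Filter.Eventually.of_forall fun y => ?_)
    · obtain ⟨W, hW, hWV⟩ : ∃ W : ℝ → ℝ, Continuous W ∧ ∀ y, V |y| = W y :=
        ⟨_, hV.cont, fun _ => rfl⟩
      simp only [hWV, bargmannKernel]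
      exact Continuous.aestronglyMeasurable (by fun_prop)
    · rw [Real.norm_of_nonneg (mul_nonneg (Real.exp_pos _).le (bargmannKernel_pos x y).le)]
      exact hb y
  refine ⟨hint, (integral_mono hint hi' hb).trans (le_of_eq ?_)⟩
  rw [integral_const_mul, mul_comm,
    integral_sub_right_eq_self (fun v => Real.exp (-v ^ 2 + r * D * V |v| + 0 * |v|))]

end IsGrowth

/-! ### The Bargmann transform in several variables and the lattice hypothesis. -/

/-- The Cauchy radius R = 2(|x| + 1) makes |x|/R ≤ 1/2, which gives the summable majorant for
exchanging sum and integral. -/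
theorem norm_bargmann_term_le (n : ℕ) (x y : ℝ) :
    |hermiteFun n y * (x ^ n / √n.factorial)| ≤
      Real.exp (-(y ^ 2 / 2)) * Real.exp (√2 * (2 * (|x| + 1)) * |y| + (2 * (|x| + 1)) ^ 2 / 2) *
        (1 / 2) ^ n := by
  have hR : 0 < 2 * (|x| + 1) := by positivity
  have hf : 0 < √(n.factorial : ℝ) := by positivity
  rw [abs_mul, abs_div, abs_pow, abs_of_pos hf]
  refine (mul_le_mul_of_nonneg_right (abs_hermiteFun_le n y hR) (by positivity)).trans ?_
  have h1 : |x| ^ n / (2 * (|x| + 1)) ^ n ≤ (1 / 2) ^ n := by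
    rw [← div_pow]
    refine pow_le_pow_left₀ (by positivity) ?_ n
    rw [div_le_div_iff₀ hR (by norm_num)]; linarith [abs_nonneg x]
  calc _ = Real.exp (-(y ^ 2 / 2)) * Real.exp (√2 * |y| * (2 * (|x| + 1)) + (2 * (|x| + 1)) ^ 2 / 2)
        * (|x| ^ n / (2 * (|x| + 1)) ^ n) := by field_simp
    _ ≤ Real.exp (-(y ^ 2 / 2)) * Real.exp (√2 * |y| * (2 * (|x| + 1)) + (2 * (|x| + 1)) ^ 2 / 2)
        * (1 / 2) ^ n := by gcongr
    _ = _ := by ring_nf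

theorem hasSum_bargmann_transform {V : ℝ → ℝ} (hV : IsGrowth V) {r : ℝ} (hr : 0 ≤ r) {d : ℕ}
    {g : EuclideanSpace ℝ (Fin d) → ℂ} (hg : AEStronglyMeasurable g) {B : ℝ}
    (hB : ∀ᵐ y, ‖g y‖ ≤ B * ∏ j, Real.exp (-((y j) ^ 2 / 2) + r * V |y j|)) (x : Fin d → ℝ) :
    HasSum (fun α : Fin d → ℕ => (∫ y, g y * (hermiteFunMulti α y : ℂ)) *
        ((∏ j, ((x j) ^ α j / √(α j).factorial) : ℝ) : ℂ))
      (∫ y, g y * ((∏ j, bargmannKernel (x j) (y j) : ℝ) : ℂ)) := by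
  set φ : Fin d → ℝ → ℝ := fun j y => Real.exp (-(y ^ 2 / 2) + r * V |y|) *
    (Real.exp (-(y ^ 2 / 2)) *
      Real.exp (√2 * (2 * (|x j| + 1)) * |y| + (2 * (|x j| + 1)) ^ 2 / 2)) with hφ
  have hφ0 : ∀ j y, 0 ≤ φ j y := fun j y => by positivity
  have hφi : ∀ j, Integrable (φ j) := by
    intro j
    have := (hV.integrable_gauss hr (√2 * (2 * (|x j| + 1)))).const_mul
      (Real.exp ((2 * (|x j| + 1)) ^ 2 / 2))
    refine this.congr (Filter.Eventually.of_forall fun y => ?_)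
    simp only [hφ, ← Real.exp_add]
    ring_nf
  have hgeo : ∀ y : EuclideanSpace ℝ (Fin d),
      HasSum (fun α : Fin d → ℕ => |B| * ∏ j, (φ j (y j) * (1 / 2) ^ α j))
        (|B| * ∏ j, (φ j (y j) * 2)) := by
    intro y
    have := (summable_norm_pi_prod_and_hasSum (fun j n => φ j (y j) * (1 / 2 : ℝ) ^ n)
      fun j => by
        simpa using (summable_geometric_two.mul_left (φ j (y j))).norm).2
    simp only [tsum_mul_left, tsum_geometric_two] at this
    exact this.mul_left _
  simp_rw [← integral_mul_const]
  refine hasSum_integral_of_dominated_convergence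
    (fun α y => |B| * ∏ j, (φ j (y j) * (1 / 2) ^ α j)) (fun α => ?_) (fun α => ?_) ?_ ?_ ?_
  · refine (hg.mul ?_).mul_const _
    exact (Complex.continuous_ofReal.comp (continuous_hermiteFunMulti α)).aestronglyMeasurable
  · filter_upwards [hB] with y hy
    rw [mul_assoc, norm_mul, ← Complex.ofReal_mul, Complex.norm_real, hermiteFunMulti,
      ← Finset.prod_mul_distrib, norm_prod]
    have h1 : ‖g y‖ ≤ |B| * ∏ j, Real.exp (-((y j) ^ 2 / 2) + r * V |y j|) :=
      hy.trans (mul_le_mul_of_nonneg_right (le_abs_self B)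
        (Finset.prod_nonneg fun j _ => (Real.exp_pos _).le))
    refine (mul_le_mul h1 (Finset.prod_le_prod (fun j _ => norm_nonneg _)
      fun j _ => norm_bargmann_term_le (α j) (x j) (y j))
      (Finset.prod_nonneg fun j _ => norm_nonneg _)
      (mul_nonneg (abs_nonneg _) (Finset.prod_nonneg fun j _ => (Real.exp_pos _).le))).trans
      (le_of_eq ?_)
    rw [mul_assoc, ← Finset.prod_mul_distrib]
    congr 1
    exact Finset.prod_congr rfl fun j _ => by simp only [hφ]; ring
  · exact Filter.Eventually.of_forall fun y => (hgeo y).summable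
  · simp_rw [fun y => (hgeo y).tsum_eq]
    exact (integrable_euclidean_prod (f := fun j y => φ j y * 2)
      fun j => (hφi j).mul_const 2).const_mul _
  · refine Filter.Eventually.of_forall fun y => ?_
    have hp := (summable_norm_pi_prod_and_hasSum
      (fun j n => hermiteFun n (y j) * ((x j) ^ n / √n.factorial)) fun j => ?_).2
    · simp only [(hasSum_bargmannKernel _ _).tsum_eq] at hp
      have := ((Complex.hasSum_ofReal).mpr hp).mul_left (g y)
      refine hasSum_of_eq this (fun α => ?_) rfl
      rw [hermiteFunMulti, mul_assoc, ← Complex.ofReal_mul, ← Finset.prod_mul_distrib]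
    · exact (hasSum_bargmannKernel (x j) (y j)).summable.norm

theorem IsGrowth.exists_transform_bound {V : ℝ → ℝ} (hV : IsGrowth V) {r : ℝ} (hr : 0 ≤ r) (d : ℕ) :
    ∃ C r₁ : ℝ, 0 ≤ C ∧ 0 ≤ r₁ ∧ ∀ (g : EuclideanSpace ℝ (Fin d) → ℂ) (B : ℝ),
      AEStronglyMeasurable g →
      (∀ᵐ y, ‖g y‖ ≤ B * ∏ j, Real.exp (-((y j) ^ 2 / 2) + r * V |y j|)) → ∀ x : Fin d → ℝ,
      ‖∑' α : Fin d → ℕ, (∫ y, g y * (hermiteFunMulti α y : ℂ)) *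
        ((∏ j, ((x j) ^ α j / √(α j).factorial) : ℝ) : ℂ)‖ ≤
        |B| * C * ∏ j, Real.exp (r₁ * V |x j|) := by
  obtain ⟨C, r₁, hC, hr₁, h⟩ := hV.bargmann_bound hr
  refine ⟨C ^ d, r₁, by positivity, hr₁, fun g B hg hB x => ?_⟩
  rw [(hasSum_bargmann_transform hV hr hg hB x).tsum_eq]
  have hi := (integrable_euclidean_prod (f := fun j y =>
    Real.exp (-(y ^ 2 / 2) + r * V |y|) * bargmannKernel (x j) y) fun j => (h (x j)).1).const_mul |B|
  refine (norm_integral_le_of_norm_le hi ?_).trans ?_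
  · filter_upwards [hB] with y hy
    have h0 : 0 ≤ ∏ j, bargmannKernel (x j) (y j) :=
      Finset.prod_nonneg fun j _ => (bargmannKernel_pos _ _).le
    rw [norm_mul, Complex.norm_real, Real.norm_of_nonneg h0, Finset.prod_mul_distrib, ← mul_assoc]
    refine mul_le_mul_of_nonneg_right (hy.trans (mul_le_mul_of_nonneg_right (le_abs_self B) ?_)) h0
    exact Finset.prod_nonneg fun j _ => (Real.exp_pos _).le
  · rw [integral_const_mul, integral_euclidean_prod fun j y =>
      Real.exp (-(y ^ 2 / 2) + r * V |y|) * bargmannKernel (x j) y]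
    have : ∏ j, ∫ y, Real.exp (-(y ^ 2 / 2) + r * V |y|) * bargmannKernel (x j) y ≤
        ∏ j, (C * Real.exp (r₁ * V |x j|)) :=
      Finset.prod_le_prod (fun j _ => integral_nonneg fun y =>
        mul_nonneg (Real.exp_pos _).le (bargmannKernel_pos _ _).le) fun j _ => (h (x j)).2
    rw [Finset.prod_mul_distrib, Finset.prod_const, Finset.card_univ, Fintype.card_fin] at this
    rw [mul_assoc]
    gcongr

/-- Only a bound uniform in α is needed, so |g h| ≤ |g|² + |h|² with normalized h suffices. -/
theorem norm_hermiteCoeff_le {d : ℕ} {g : EuclideanSpace ℝ (Fin d) → ℂ} (hg : MemLp g 2 volume)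
    (α : Fin d → ℕ) : ‖∫ y, g y * (hermiteFunMulti α y : ℂ)‖ ≤ (∫ y, ‖g y‖ ^ 2) + 1 := by
  have h1 : Integrable fun y => ‖g y‖ ^ 2 := (memLp_two_iff_integrable_sq_norm hg.1).mp hg
  have h2 := integrable_hermiteFunMulti_mul α α
  refine (norm_integral_le_of_norm_le (h1.add h2) (Filter.Eventually.of_forall fun y => ?_)).trans
    (le_of_eq ?_)
  · rw [norm_mul, Complex.norm_real, Real.norm_eq_abs]
    simp only [Pi.add_apply]
    nlinarith [sq_nonneg (‖g y‖ - |hermiteFunMulti α y|), abs_mul_abs_self (hermiteFunMulti α y),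
      sq_nonneg ‖g y‖, mul_self_nonneg (hermiteFunMulti α y)]
  · simp only [Pi.add_apply]
    rw [integral_add h1 h2, integral_hermiteFunMulti_mul, if_pos rfl]

theorem fracFourier_phase {d : ℕ} (t : Fin d → ℝ) (α : Fin d → ℕ) :
    Complex.exp (-(Complex.I * (Real.pi / 2 : ℝ) * ((∑ j, t j * α j : ℝ) : ℂ))) =
      ∏ j, ray (t j) ^ α j := by
  simp only [ray, ← Complex.exp_nat_mul]
  rw [← Complex.exp_sum]
  congr 1
  push_cast
  rw [Finset.mul_sum, ← Finset.sum_neg_distrib]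
  exact Finset.sum_congr rfl fun j _ => by ring

/-- The coefficient estimates that follow from bounds on the lattice of partial fractional
Fourier transforms. -/
theorem IsGrowth.exists_coeff_bound_of_lattice {V : ℝ → ℝ} (hV : IsGrowth V) {r : ℝ} (hr : 0 ≤ r)
    {d : ℕ} (t₀ u : Fin d → ℝ) (hu : ∀ j, u j ∈ Set.Ioo (0 : ℝ) 1) (f : FormalHermite d) (B : ℝ)
    (h : ∀ t ∈ latticeSet t₀ u, ∃ g, (f.fracFourier t).Represents g ∧
      ∀ᵐ y, ‖g y‖ ≤ B * (Real.exp (-(‖y‖ ^ 2 / 2)) * Real.exp (r * V ‖y‖))) :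
    ∃ A r₁ : ℝ, 0 ≤ A ∧ 0 ≤ r₁ ∧ ∀ (α : Fin d → ℕ) (R : Fin d → ℝ), (∀ j, 1 ≤ R j) →
      ‖f.coeff α‖ ≤ A * ∏ j, (√(α j).factorial * Real.exp (r₁ * V (R j)) / R j ^ α j) := by
  obtain ⟨D, hD, hVD⟩ := hV.norm_le_sum d
  obtain ⟨C₁, r₁, hC₁, hr₁, hT⟩ := hV.exists_transform_bound (r := r * D) (by positivity) d
  obtain ⟨C₂, r₂, hC₂, hr₂, hP⟩ := hV.exists_coeffBound_forall hr₁ hu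
  have hnorm : ∀ t α, ‖(f.fracFourier t).coeff α‖ = ‖f.coeff α‖ := by
    intro t α
    simp only [FormalHermite.fracFourier]
    rw [fracFourier_phase, norm_mul, norm_prod]
    simp [norm_ray]
  obtain ⟨M, hM⟩ : ∃ M, ∀ α, ‖f.coeff α‖ ≤ M := by
    -- The lattice point k = 0 alone bounds all coefficients, since the phases have modulus one.
    -- This supplies the a priori order-two growth for Phragmén–Lindelöf.
    obtain ⟨g, hg, -⟩ := h t₀ ⟨0, by simp, by simp⟩
    refine ⟨(∫ y, ‖g y‖ ^ 2) + 1, fun α => ?_⟩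
    rw [← hnorm t₀, hg.2 α]
    exact norm_hermiteCoeff_le hg.1 α
  have key := CoeffBound.multi u hP t₀ (fun α => f.coeff α / ((∏ j, √(α j).factorial : ℝ) : ℂ)) M
    (|B| * C₁) (fun α => ?_) (fun t ht x => ?_)
  · refine ⟨|B| * C₁ * C₂ ^ d, r₂, by positivity, hr₂, fun α R hR => ?_⟩
    have h0 : 0 < ∏ j, √((α j).factorial : ℝ) := Finset.prod_pos fun j _ => by positivity
    have := key α R hR
    rw [norm_div, Complex.norm_real, Real.norm_of_nonneg h0.le, div_le_iff₀ h0] at this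
    refine this.trans (le_of_eq ?_)
    simp only [mul_div_assoc, Finset.prod_mul_distrib, Finset.prod_const, Finset.card_univ,
      Fintype.card_fin]
    ring
  · have h0 : 0 < ∏ j, √((α j).factorial : ℝ) := Finset.prod_pos fun j _ => by positivity
    rw [norm_div, Complex.norm_real, Real.norm_of_nonneg h0.le]
    gcongr
    exact hM α
  · obtain ⟨g, hg, hgB⟩ := h t (by
      choose k hk hk' using ht
      exact ⟨k, hk, hk'⟩)
    have h1 := hT g |B| hg.1.1 (by
      filter_upwards [hgB] with y hy
      refine hy.trans (mul_le_mul (le_abs_self B) ?_ (by positivity) (abs_nonneg B))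
      rw [← Real.exp_add, ← Real.exp_sum, Real.exp_le_exp, Finset.sum_add_distrib,
        Finset.sum_neg_distrib, ← Finset.sum_div, ← Finset.mul_sum, EuclideanSpace.norm_sq_eq]
      simp only [Real.norm_eq_abs, sq_abs]
      have := mul_le_mul_of_nonneg_left (hVD y) hr
      linarith) x
    rw [abs_abs] at h1
    refine le_trans (le_of_eq ?_) h1
    congr 1
    refine tsum_congr fun α => ?_
    rw [← hg.2 α]
    simp only [FormalHermite.fracFourier]
    rw [fracFourier_phase]
    push_cast
    simp only [mul_pow, Finset.prod_mul_distrib, Finset.prod_div_distrib]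
    ring

/-! ### The two families of growth functions. -/

/-- The holomorphic majorant is ψ(w) = e^{ρw} / cos(ρπu/4); ρ < 2 and u < 1 keep |ρ Im w| below π/2.
-/
theorem isGrowth_rpow {ρ : ℝ} (h0 : 0 < ρ) (h2 : ρ < 2) : IsGrowth fun x => x ^ ρ where
  zero := Real.zero_rpow h0.ne'
  nonneg x hx := Real.rpow_nonneg hx _
  mono := Real.monotoneOn_rpow_Ici_of_exponent_nonneg h0.le
  cont := continuous_abs.rpow_const fun _ => Or.inr h0.le
  doubling := ⟨2 ^ ρ, Real.one_le_rpow (by norm_num) h0.le, fun x hx =>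
    (Real.mul_rpow (by norm_num) hx).le⟩
  subquad ε hε := by
    set X := (1 / ε) ^ (1 / (2 - ρ)) with hX
    have hX0 : 0 < X := by positivity
    refine ⟨X ^ ρ, by positivity, fun x hx => ?_⟩
    rcases le_total x X with h | h
    · have := Real.rpow_le_rpow hx h h0.le
      have : 0 ≤ ε * x ^ 2 := by positivity
      linarith
    · have hx0 : 0 < x := hX0.trans_le h
      have h3 : 1 / ε ≤ x ^ (2 - ρ) := by
        have := Real.rpow_le_rpow hX0.le h (by linarith : 0 ≤ 2 - ρ)
        rwa [hX, ← Real.rpow_mul (by positivity), one_div_mul_cancel (by linarith),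
          Real.rpow_one] at this
      have h4 : x ^ 2 = x ^ (2 - ρ) * x ^ ρ := by
        rw [← Real.rpow_add hx0]; norm_num
      have h5 : 1 ≤ ε * x ^ (2 - ρ) := by
        rw [div_le_iff₀ hε] at h3; linarith
      have : 0 < X ^ ρ := by positivity
      have h6 := mul_le_mul_of_nonneg_right h5 (Real.rpow_nonneg hx ρ)
      rw [h4]; linarith
  sector u hu := by
    have hπ := Real.pi_pos
    have hk : 0 < Real.cos (ρ * (Real.pi * u / 4)) := by
      have h1 : 0 < ρ * (Real.pi * u / 4) := by have := hu.1; positivity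
      refine Real.cos_pos_of_mem_Ioo ⟨by linarith, ?_⟩
      have := hu.2
      have h3 : ρ * u < 2 := by nlinarith [hu.1]
      nlinarith
    set K := (Real.cos (ρ * (Real.pi * u / 4)))⁻¹ with hK
    have hK0 : 0 < K := by positivity
    have he : ∀ w : ℂ, ((ρ : ℂ) * w) = ((ρ * w.re : ℝ) : ℂ) + ((ρ * w.im : ℝ) : ℂ) * Complex.I := by
      intro w
      conv_lhs => rw [← Complex.re_add_im w]
      push_cast; ring
    have hpow : ∀ x : ℝ, Real.exp x ^ ρ = Real.exp (ρ * x) := fun x => by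
      rw [← Real.exp_mul, mul_comm]
    refine ⟨fun w => (K : ℂ) * Complex.exp ((ρ : ℂ) * w), K, hK0.le, fun w hw => ⟨by fun_prop, ?_⟩,
      fun w hw hw0 => ?_⟩
    · simp only [hpow]
      rw [Complex.re_ofReal_mul, Complex.exp_re, Complex.re_ofReal_mul, Complex.im_ofReal_mul]
      have h1 : Real.cos (ρ * (Real.pi * u / 4)) ≤ Real.cos (ρ * w.im) := by
        rw [← Real.cos_abs (ρ * w.im)]
        refine Real.cos_le_cos_of_nonneg_of_le_pi (abs_nonneg _) ?_ ?_
        · nlinarith [hu.2, hu.1, mul_lt_mul'' h2 hu.2 h0.le hu.1.le]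
        · rw [abs_mul, abs_of_pos h0]; gcongr
      have h2 : 1 ≤ K * Real.cos (ρ * w.im) := by
        rw [hK, ← div_eq_inv_mul, le_div_iff₀ hk]; linarith
      calc Real.exp (ρ * w.re) = Real.exp (ρ * w.re) * 1 := (mul_one _).symm
        _ ≤ Real.exp (ρ * w.re) * (K * Real.cos (ρ * w.im)) := by gcongr
        _ = _ := by ring
    · simp only [hpow]
      rw [norm_mul, Complex.norm_exp, Complex.re_ofReal_mul, Complex.norm_real,
        Real.norm_of_nonneg hK0.le]
      gcongr
      linarith

/-- `log ⟨x⟩`. -/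
def logBracket (x : ℝ) : ℝ := Real.log √(1 + x ^ 2)

theorem one_le_sqrt_bracket (x : ℝ) : 1 ≤ √(1 + x ^ 2) := by
  rw [Real.one_le_sqrt]; nlinarith [sq_nonneg x]

theorem logBracket_nonneg (x : ℝ) : 0 ≤ logBracket x := Real.log_nonneg (one_le_sqrt_bracket x)

theorem logBracket_eq (x : ℝ) : logBracket x = Real.log (1 + x ^ 2) / 2 :=
  Real.log_sqrt (by positivity)

theorem logBracket_exp_le (x : ℝ) : logBracket (Real.exp x) ≤ |x| + 1 := by
  rw [logBracket_eq, div_le_iff₀ (by norm_num), Real.log_le_iff_le_exp (by positivity)]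
  have h1 : Real.exp x ^ 2 ≤ Real.exp (2 * |x|) := by
    rw [← Real.exp_nat_mul, Real.exp_le_exp]; push_cast; linarith [le_abs_self x]
  have h2 : 1 ≤ Real.exp (2 * |x|) := Real.one_le_exp (by positivity)
  have h3 : (2 : ℝ) ≤ Real.exp 2 := by linarith [Real.add_one_le_exp 2]
  calc 1 + Real.exp x ^ 2 ≤ 2 * Real.exp (2 * |x|) := by linarith
    _ ≤ Real.exp 2 * Real.exp (2 * |x|) := by gcongr
    _ = _ := by rw [← Real.exp_add]; ring_nf

theorem le_logBracket_exp (x : ℝ) : x ≤ logBracket (Real.exp x) := by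
  rw [logBracket_eq, le_div_iff₀ (by norm_num), Real.le_log_iff_exp_le (by positivity),
    ← Real.exp_nat_mul]
  have : Real.exp (x * 2) = Real.exp (((2 : ℕ) : ℝ) * x) := by push_cast; ring_nf
  linarith

theorem one_add_rpow_le {x p : ℝ} (hx : 0 ≤ x) (hp : 0 ≤ p) : (1 + x) ^ p ≤ 2 ^ p * (1 + x ^ p) := by
  have hxp := Real.rpow_nonneg hx p
  rcases le_total x 1 with h | h
  · calc (1 + x) ^ p ≤ 2 ^ p := Real.rpow_le_rpow (by linarith) (by linarith) hp
      _ ≤ _ := le_mul_of_one_le_right (by positivity) (by linarith)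
  · calc (1 + x) ^ p ≤ (2 * x) ^ p := Real.rpow_le_rpow (by linarith) (by linarith) hp
      _ = 2 ^ p * x ^ p := Real.mul_rpow (by norm_num) hx
      _ ≤ _ := by gcongr; linarith

/-- A branch of `(w² + 1 + γ²)^(γ/2)`, holomorphic near the strip `|Im w| ≤ 1`. -/
def logSectorFun (γ : ℝ) (w : ℂ) : ℂ :=
  Complex.exp ((γ / 2 : ℝ) * Complex.log (w ^ 2 + (1 + γ ^ 2 : ℝ)))

/-- For q = w² + 1 + γ² on the strip, |Im q|/|q| ≤ 2|Re w|/((Re w)² + γ²) ≤ 1/γ. Jordan's inequality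
gives |arg q| ≤ π/(2γ), so q^{γ/2} has argument at most π/4 and its real part is comparable to its
modulus. -/
theorem logSectorFun_spec {γ : ℝ} (hγ : 1 ≤ γ) {w : ℂ} (hw : |w.im| ≤ 1) :
    DifferentiableAt ℂ (logSectorFun γ) w ∧
      (|w.re| + 1) ^ γ ≤ 2 * 2 ^ (γ / 2) * (logSectorFun γ w).re ∧
      ‖logSectorFun γ w‖ ≤ ((2 + γ ^ 2) * (1 + |w.re|)) ^ γ := by
  set q : ℂ := w ^ 2 + (1 + γ ^ 2 : ℝ) with hq
  have hy2 : w.im ^ 2 ≤ 1 := by rw [← sq_abs]; exact pow_le_one₀ (abs_nonneg _) hw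
  have hre : q.re = w.re ^ 2 - w.im ^ 2 + (1 + γ ^ 2) := by
    rw [hq]; simp [pow_two]
  have him : q.im = 2 * (w.re * w.im) := by
    rw [hq]; simp [pow_two]; ring
  have hre' : w.re ^ 2 + γ ^ 2 ≤ q.re := by rw [hre]; linarith
  have hγ2 : 1 ≤ γ ^ 2 := one_le_pow₀ hγ
  have hre0 : 0 < q.re := by nlinarith [sq_nonneg w.re]
  have hq0 : q ≠ 0 := fun h => by rw [h] at hre0; simp at hre0
  have hqn : q.re ≤ ‖q‖ := Complex.re_le_norm q
  have hqpos : 0 < ‖q‖ := norm_pos_iff.mpr hq0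
  have hnorm : ‖logSectorFun γ w‖ = ‖q‖ ^ (γ / 2) := by
    rw [logSectorFun, Complex.norm_exp, Complex.re_ofReal_mul, Complex.log_re,
      Real.rpow_def_of_pos hqpos, mul_comm]
  have harg : |γ / 2 * q.arg| ≤ Real.pi / 4 := by
    have h1 : |q.arg| ≤ Real.pi / 2 := Complex.abs_arg_le_pi_div_two_iff.mpr hre0.le
    have h2 := Real.mul_le_sin (abs_nonneg q.arg) h1
    have h3 : Real.sin |q.arg| = |q.im| / ‖q‖ := by
      have : Real.sin |q.arg| = |Real.sin q.arg| := by
        rw [Real.abs_sin_eq_sin_abs_of_abs_le_pi (Complex.abs_arg_le_pi q)]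
      rw [this, Complex.sin_arg, abs_div, abs_norm]
    have h4 : |q.im| / ‖q‖ ≤ 1 / γ := by
      rw [div_le_div_iff₀ hqpos (by linarith), one_mul, him, abs_mul, abs_two, abs_mul]
      have h5 : |w.re| * |w.im| ≤ |w.re| := mul_le_of_le_one_right (abs_nonneg _) hw
      have h6 : |w.re| ^ 2 = w.re ^ 2 := sq_abs _
      nlinarith [sq_nonneg (|w.re| - γ)]
    rw [h3] at h2
    have hπ := Real.pi_pos
    have h7 : |q.arg| ≤ Real.pi / 2 * (1 / γ) := by
      have := h2.trans h4
      calc |q.arg| = Real.pi / 2 * (2 / Real.pi * |q.arg|) := by field_simp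
        _ ≤ _ := by gcongr
    rw [abs_mul, abs_of_pos (by linarith : 0 < γ / 2)]
    calc γ / 2 * |q.arg| ≤ γ / 2 * (Real.pi / 2 * (1 / γ)) := by gcongr
      _ = Real.pi / 4 := by field_simp; norm_num
  refine ⟨?_, ?_, ?_⟩
  · have : q ∈ Complex.slitPlane := Or.inl hre0
    have hd : DifferentiableAt ℂ (fun w : ℂ => w ^ 2 + ((1 + γ ^ 2 : ℝ) : ℂ)) w := by fun_prop
    exact ((hd.clog this).const_mul _).cexp
  · have hcos : 1 / 2 ≤ Real.cos (γ / 2 * q.arg) := by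
      rw [← Real.cos_abs]
      have h1 := Real.cos_le_cos_of_nonneg_of_le_pi (abs_nonneg _)
        (by linarith [Real.pi_pos] : Real.pi / 4 ≤ Real.pi) harg
      rw [Real.cos_pi_div_four] at h1
      have : 1 ≤ √2 := by rw [Real.one_le_sqrt]; norm_num
      linarith
    have hpre : (logSectorFun γ w).re = ‖q‖ ^ (γ / 2) * Real.cos (γ / 2 * q.arg) := by
      rw [← hnorm, logSectorFun, Complex.exp_re, Complex.norm_exp, Complex.im_ofReal_mul,
        Complex.log_im]
    have h3 : (|w.re| + 1) ^ 2 ≤ 2 * ‖q‖ := by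
      nlinarith [sq_nonneg (|w.re| - 1), sq_abs w.re]
    have h4 : (|w.re| + 1) ^ γ ≤ 2 ^ (γ / 2) * ‖q‖ ^ (γ / 2) := by
      rw [← Real.mul_rpow (by norm_num) hqpos.le]
      calc (|w.re| + 1) ^ γ = ((|w.re| + 1) ^ 2) ^ (γ / 2) := by
            rw [← Real.rpow_natCast, ← Real.rpow_mul (by positivity)]
            congr 1; push_cast; ring
        _ ≤ _ := Real.rpow_le_rpow (by positivity) h3 (by linarith)
    rw [hpre]
    calc _ ≤ 2 ^ (γ / 2) * ‖q‖ ^ (γ / 2) := h4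
      _ = 2 * 2 ^ (γ / 2) * (‖q‖ ^ (γ / 2) * (1 / 2)) := by ring
      _ ≤ _ := by gcongr
  · rw [hnorm]
    have h3 : ‖q‖ ≤ ((2 + γ ^ 2) * (1 + |w.re|)) ^ 2 := by
      have h5 : ‖q‖ ≤ ‖w‖ ^ 2 + (1 + γ ^ 2) := by
        rw [hq]
        refine (norm_add_le _ _).trans ?_
        rw [norm_pow, Complex.norm_real, Real.norm_of_nonneg (by positivity)]
      rw [Complex.sq_norm, Complex.normSq_apply] at h5
      have h6 : 1 ≤ 1 + |w.re| := by linarith [abs_nonneg w.re]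
      have h7 : (2 + γ ^ 2) * (1 + |w.re|) ^ 2 ≤ ((2 + γ ^ 2) * (1 + |w.re|)) ^ 2 := by
        rw [mul_pow]; gcongr; nlinarith
      refine le_trans ?_ h7
      nlinarith [sq_abs w.re, abs_nonneg w.re, mul_nonneg (sq_nonneg γ) (abs_nonneg w.re),
        mul_nonneg (sq_nonneg γ) (sq_nonneg |w.re|)]
    calc ‖q‖ ^ (γ / 2) ≤ (((2 + γ ^ 2) * (1 + |w.re|)) ^ 2) ^ (γ / 2) :=
          Real.rpow_le_rpow hqpos.le h3 (by linarith)
      _ = _ := by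
        rw [← Real.rpow_natCast, ← Real.rpow_mul (by positivity)]
        congr 1; push_cast; ring

/-- For x ≥ 0 the value log⟨e^x⟩ lies between x and x + 1, so in the logarithmic coordinate V
behaves like (1 + x)^γ, which `logSectorFun` majorizes. The strips have half-width πu/4 ≤ 1. -/
theorem isGrowth_log {γ : ℝ} (hγ : 1 ≤ γ) : IsGrowth fun x => logBracket x ^ γ where
  zero := by simp [logBracket, Real.zero_rpow (by linarith : γ ≠ 0)]
  nonneg x _ := Real.rpow_nonneg (logBracket_nonneg x) _
  mono x hx y hy hxy := by
    refine Real.rpow_le_rpow (logBracket_nonneg x) ?_ (by linarith)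
    have : 0 < √(1 + x ^ 2) := by positivity
    unfold logBracket
    have hx' : 0 ≤ x := hx
    gcongr
  cont := by
    refine Continuous.rpow_const ?_ fun _ => Or.inr (by linarith)
    unfold logBracket
    refine Continuous.log (by fun_prop) fun x => ?_
    positivity
  doubling := by
    refine ⟨4 ^ γ, Real.one_le_rpow (by norm_num) (by linarith), fun x _ => ?_⟩
    rw [← Real.mul_rpow (by norm_num) (logBracket_nonneg x)]
    refine Real.rpow_le_rpow (logBracket_nonneg _) ?_ (by linarith)
    rw [logBracket_eq, logBracket_eq]
    have h : Real.log (1 + (2 * x) ^ 2) ≤ Real.log ((1 + x ^ 2) ^ 4) := by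
      refine Real.log_le_log (by positivity) ?_
      nlinarith [sq_nonneg x, sq_nonneg (x ^ 2), sq_nonneg (x ^ 3), sq_nonneg (x ^ 4)]
    rw [Real.log_pow] at h
    push_cast at h
    linarith
  subquad ε hε := by
    have hγ0 : 0 < γ := by linarith
    set K := γ ^ γ with hK
    refine ⟨ε + K ^ 2 / (4 * ε), by positivity, fun x _ => ?_⟩
    have hq := one_le_sqrt_bracket x
    set q := √(1 + x ^ 2) with hqd
    have hq2 : q ^ 2 = 1 + x ^ 2 := Real.sq_sqrt (by positivity)
    -- This makes V at most linear in ⟨x⟩, after which completing a square gives the ε-bound.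
    have h1 : logBracket x ≤ q ^ (1 / γ) * γ := by
      have := Real.log_le_rpow_div (x := q) (by linarith) (ε := 1 / γ) (by positivity)
      rw [div_div_eq_mul_div, div_one] at this
      exact this
    have h2 : logBracket x ^ γ ≤ q * K := by
      refine (Real.rpow_le_rpow (logBracket_nonneg x) h1 hγ0.le).trans (le_of_eq ?_)
      rw [Real.mul_rpow (by positivity) hγ0.le, ← Real.rpow_mul (by positivity),
        one_div_mul_cancel hγ0.ne', Real.rpow_one]
    have h3 : q * K ≤ ε * q ^ 2 + K ^ 2 / (4 * ε) := by
      have : ε * q ^ 2 + K ^ 2 / (4 * ε) - q * K = (2 * ε * q - K) ^ 2 / (4 * ε) := by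
        field_simp; ring
      have h5 : 0 ≤ (2 * ε * q - K) ^ 2 / (4 * ε) := by positivity
      linarith
    rw [hq2] at h3
    linarith
  sector u hu := by
    have hγ0 : 0 < γ := by linarith
    have hstrip : ∀ w : ℂ, |w.im| ≤ Real.pi * u / 4 → |w.im| ≤ 1 := by
      intro w hw
      nlinarith [Real.pi_le_four, Real.pi_pos, hu.1, hu.2]
    set K : ℝ := 2 * 2 ^ (γ / 2) with hK
    have hK0 : 0 < K := by positivity
    refine ⟨fun w => (K : ℂ) * logSectorFun γ w, K * ((2 + γ ^ 2) ^ γ * 2 ^ γ), by positivity,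
      fun w hw => ?_, fun w hw hw0 => ?_⟩
    · obtain ⟨h1, h2, -⟩ := logSectorFun_spec hγ (hstrip w hw)
      refine ⟨h1.const_mul _, ?_⟩
      rw [Complex.re_ofReal_mul]
      exact (Real.rpow_le_rpow (logBracket_nonneg _) (logBracket_exp_le _) hγ0.le).trans h2
    · obtain ⟨-, -, h3⟩ := logSectorFun_spec hγ (hstrip w hw)
      rw [norm_mul, Complex.norm_real, Real.norm_of_nonneg hK0.le, mul_assoc K]
      refine mul_le_mul_of_nonneg_left (h3.trans ?_) hK0.le
      rw [abs_of_nonneg hw0, Real.mul_rpow (by positivity) (by positivity), mul_assoc]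
      refine mul_le_mul_of_nonneg_left ((one_add_rpow_le hw0 hγ0.le).trans ?_) (by positivity)
      refine mul_le_mul_of_nonneg_left ?_ (by positivity)
      have := Real.rpow_le_rpow hw0 (le_logBracket_exp w.re) hγ0.le
      linarith

/-! ### Optimizing the Cauchy radii. -/

theorem exists_forall_le_add_of_eventually {f g : ℕ → ℝ} (h : ∀ᶠ n in Filter.atTop, f n ≤ g n) :
    ∃ C, 0 ≤ C ∧ ∀ n, f n ≤ g n + C := by
  obtain ⟨N, hN⟩ := Filter.eventually_atTop.mp h
  refine ⟨∑ n ∈ Finset.range N, |f n - g n|, Finset.sum_nonneg fun _ _ => abs_nonneg _, fun n => ?_⟩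
  rcases lt_or_ge n N with hn | hn
  · have := Finset.single_le_sum (f := fun n => |f n - g n|) (fun i _ => abs_nonneg _)
      (Finset.mem_range.mpr hn)
    have h2 := le_abs_self (f n - g n)
    linarith
  · have := hN n hn
    have : 0 ≤ ∑ n ∈ Finset.range N, |f n - g n| := Finset.sum_nonneg fun _ _ => abs_nonneg _
    linarith [hN n hn]

theorem sqrt_factorial_le_exp {p η : ℝ} (hp : 1 < p) (hη : 0 < η) :
    ∃ C, 0 ≤ C ∧ ∀ n : ℕ, √n.factorial ≤ Real.exp (η * (n : ℝ) ^ p + C) := by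
  have h1 : ∀ᶠ n : ℕ in Filter.atTop, Real.log √n.factorial ≤ η * (n : ℝ) ^ p := by
    have h := (isLittleO_log_rpow_atTop (r := p - 1) (by linarith)).bound hη
    filter_upwards [tendsto_natCast_atTop_atTop.eventually h, Filter.eventually_ge_atTop 1]
      with n hn hn1
    have hn0 : (0 : ℝ) < n := by exact_mod_cast hn1
    have hl : 0 ≤ Real.log n := Real.log_natCast_nonneg n
    rw [Real.norm_of_nonneg hl, Real.norm_of_nonneg (by positivity)] at hn
    have h2 : Real.log n.factorial ≤ n * Real.log n := by
      rw [← Real.log_pow]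
      exact Real.log_le_log (by positivity) (by exact_mod_cast n.factorial_le_pow)
    have h3 : (n : ℝ) ^ p = n * (n : ℝ) ^ (p - 1) := by
      rw [← Real.rpow_one_add' hn0.le (by linarith)]; congr 1; ring
    have h4 : 0 ≤ Real.log n.factorial := Real.log_natCast_nonneg _
    rw [Real.log_sqrt (by positivity), h3]
    nlinarith [mul_le_mul_of_nonneg_left hn hn0.le]
  obtain ⟨C, hC, h⟩ := exists_forall_le_add_of_eventually h1
  exact ⟨C, hC, fun n => (Real.log_le_iff_le_exp (by positivity)).mp (h n)⟩

/-- The coefficient estimate obtained from the bound on lattices, before optimizing the radii. -/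
def RadiusBound (V : ℝ → ℝ) (r₁ : ℝ) (b : ℕ → ℝ) : Prop :=
  ∀ n : ℕ, ∃ R, 1 ≤ R ∧ √n.factorial * Real.exp (r₁ * V R) / R ^ n ≤ b n

theorem norm_le_of_radiusBound {V : ℝ → ℝ} {r₁ : ℝ} {b : ℕ → ℝ} (hb : RadiusBound V r₁ b) {d : ℕ}
    {c : (Fin d → ℕ) → ℂ} {A : ℝ} (hA : 0 ≤ A)
    (h : ∀ (α : Fin d → ℕ) (R : Fin d → ℝ), (∀ j, 1 ≤ R j) →
      ‖c α‖ ≤ A * ∏ j, (√(α j).factorial * Real.exp (r₁ * V (R j)) / R j ^ α j))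
    (α : Fin d → ℕ) : ‖c α‖ ≤ A * ∏ j, b (α j) := by
  choose R hR hRb using hb
  refine (h α (fun j => R (α j)) fun j => hR _).trans ?_
  refine mul_le_mul_of_nonneg_left (Finset.prod_le_prod (fun j _ => ?_) fun j _ => hRb _) hA
  have := hR (α j)
  positivity

/-- The exponents p = 1/(2s) and γ = 1/(1-2s) are conjugate, so (p-1)γ = p. The radius exp(δ
n^{p-1}) gains δ n^p in R^n and costs a multiple of δ^γ n^p in V. As γ > 1, a small δ keeps this
cost below δ/4; √n! costs another δ/4, and δ/2 remains. -/
theorem radiusBound_log {s : ℝ} (hs0 : 0 < s) (hs : s < 1 / 2) {r₁ : ℝ} (hr₁ : 0 ≤ r₁) :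
    ∃ K ε : ℝ, 0 ≤ K ∧ 0 < ε ∧ RadiusBound (fun x => logBracket x ^ (1 / (1 - 2 * s))) r₁
      fun n => K * Real.exp (-ε * (n : ℝ) ^ (1 / (2 * s))) := by
  set γ := 1 / (1 - 2 * s) with hγd
  set p := 1 / (2 * s) with hpd
  have h12 : 0 < 1 - 2 * s := by linarith
  have hγ : 1 < γ := by rw [hγd, lt_div_iff₀ h12]; linarith
  have hp : 1 < p := by rw [hpd, lt_div_iff₀ (by linarith)]; linarith
  have hpγ : (p - 1) * γ = p := by
    rw [hγd, hpd]; field_simp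
  set T := 4 * (r₁ + 1) * 2 ^ γ with hT
  have hT0 : 0 < T := by positivity
  set δ := (1 / T) ^ (1 / (γ - 1)) with hδ
  have hδ0 : 0 < δ := by positivity
  have hδγ : r₁ * 2 ^ γ * δ ^ γ ≤ δ / 4 := by
    have h1 : δ ^ (γ - 1) = 1 / T := by
      rw [hδ, ← Real.rpow_mul (by positivity), one_div_mul_cancel (by linarith), Real.rpow_one]
    have h2 : δ ^ γ = δ * (1 / T) := by
      rw [← h1, ← Real.rpow_one_add' hδ0.le (by linarith)]; congr 1; ring
    rw [h2]
    have : r₁ * 2 ^ γ * (1 / T) ≤ 1 / 4 := by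
      rw [mul_one_div, div_le_div_iff₀ hT0 (by norm_num), hT]
      have : (0 : ℝ) < 2 ^ γ := by positivity
      linarith
    nlinarith
  obtain ⟨C, hC, hfac⟩ := sqrt_factorial_le_exp hp (by positivity : 0 < δ / 4)
  refine ⟨Real.exp (C + r₁ * 2 ^ γ), δ / 2, by positivity, by positivity, fun n => ?_⟩
  have hx : 0 ≤ δ * (n : ℝ) ^ (p - 1) := by positivity
  refine ⟨Real.exp (δ * (n : ℝ) ^ (p - 1)), Real.one_le_exp hx, ?_⟩
  have hV : logBracket (Real.exp (δ * (n : ℝ) ^ (p - 1))) ^ γ ≤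
      2 ^ γ * (1 + δ ^ γ * (n : ℝ) ^ p) := by
    have h1 := Real.rpow_le_rpow (logBracket_nonneg _)
      (logBracket_exp_le (δ * (n : ℝ) ^ (p - 1))) (by linarith : 0 ≤ γ)
    rw [abs_of_nonneg hx, add_comm] at h1
    refine h1.trans ((one_add_rpow_le hx (by linarith)).trans (le_of_eq ?_))
    rw [Real.mul_rpow hδ0.le (by positivity), ← Real.rpow_mul n.cast_nonneg, hpγ]
  have hRn : Real.exp (δ * (n : ℝ) ^ (p - 1)) ^ n = Real.exp (δ * (n : ℝ) ^ p) := by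
    rw [← Real.exp_nat_mul]
    congr 1
    rcases Nat.eq_zero_or_pos n with rfl | hn
    · simp [Real.zero_rpow (by linarith : p ≠ 0)]
    · have h3 : (n : ℝ) ^ p = n * (n : ℝ) ^ (p - 1) := by
        rw [← Real.rpow_one_add' (by positivity) (by linarith)]; congr 1; ring
      rw [h3]; ring
  rw [hRn, div_le_iff₀ (Real.exp_pos _)]
  beta_reduce
  rw [← Real.exp_add, ← Real.exp_add]
  refine (mul_le_mul_of_nonneg_right (hfac n) (Real.exp_pos _).le).trans ?_
  rw [← Real.exp_add, Real.exp_le_exp]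
  have hnp : 0 ≤ (n : ℝ) ^ p := by positivity
  nlinarith [mul_le_mul_of_nonneg_left hV hr₁, mul_le_mul_of_nonneg_right hδγ hnp]

/-- The radius n^{1/ρ} makes V(R) = n, a geometric factor, while R^n ≥ n!^{1/ρ} with 1/ρ = 1/2 +
1/(2σ); the half cancels √n!. The maximum with 1 only serves n = 0. -/
theorem radiusBound_rpow {σ : ℝ} (hσ : 0 < σ) (r₁ : ℝ) (hr₁ : 0 ≤ r₁) :
    RadiusBound (fun x => x ^ (2 * σ / (σ + 1))) r₁
      fun n => Real.exp r₁ * (Real.exp r₁ ^ n * (n.factorial : ℝ) ^ (-(1 / (2 * σ)))) := by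
  intro n
  set ρ := 2 * σ / (σ + 1) with hρ
  have hρ0 : 0 < ρ := by positivity
  have hρi : 1 / ρ = 1 / 2 + 1 / (2 * σ) := by rw [hρ]; field_simp
  have hm : (1 : ℝ) ≤ max (n : ℝ) 1 := le_max_right _ _
  refine ⟨(max (n : ℝ) 1) ^ (1 / ρ), Real.one_le_rpow hm (by positivity), ?_⟩
  have h1 : ((max (n : ℝ) 1) ^ (1 / ρ)) ^ ρ ≤ n + 1 := by
    rw [← Real.rpow_mul (by positivity), one_div_mul_cancel hρ0.ne', Real.rpow_one]
    exact max_le (by linarith) (by linarith [n.cast_nonneg (α := ℝ)])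
  have h2 : (n.factorial : ℝ) ^ (1 / ρ) ≤ ((max (n : ℝ) 1) ^ (1 / ρ)) ^ n := by
    rw [← Real.rpow_natCast, ← Real.rpow_mul (by positivity), mul_comm, Real.rpow_mul (by positivity)]
    refine Real.rpow_le_rpow (by positivity) ?_ (by positivity)
    rw [Real.rpow_natCast]
    calc (n.factorial : ℝ) ≤ (n : ℝ) ^ n := by exact_mod_cast n.factorial_le_pow
      _ ≤ _ := by gcongr; exact le_max_left _ _
  have hf : (0 : ℝ) < n.factorial := by positivity
  calc _ ≤ √n.factorial * Real.exp (r₁ * (n + 1)) / (n.factorial : ℝ) ^ (1 / ρ) := by gcongr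
    _ = _ := by
      beta_reduce
      rw [hρi, Real.rpow_add hf, Real.sqrt_eq_rpow, Real.rpow_neg hf.le, ← Real.exp_nat_mul, mul_add,
        Real.exp_add]
      have : (n.factorial : ℝ) ^ (1 / 2 : ℝ) ≠ 0 := by positivity
      field_simp

/-! ### From coefficient estimates to the sequence spaces. -/

theorem memℓp_of_norm_le_geometric {d : ℕ} {p : ℝ≥0∞} (hp : 1 ≤ p) {c : (Fin d → ℕ) → ℂ} {A q : ℝ}
    (hq0 : 0 ≤ q) (hq : q < 1) (h : ∀ α, ‖c α‖ ≤ A * ∏ j, q ^ α j) : Memℓp c p := by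
  refine Memℓp.of_exponent_ge (q := 1) (memℓp_gen ?_) hp
  have hs := ((summable_norm_pi_prod_and_hasSum (fun (_ : Fin d) n => q ^ n)
    fun _ => (summable_geometric_of_lt_one hq0 hq).norm).2.summable).mul_left A
  simpa using Summable.of_nonneg_of_le (fun _ => norm_nonneg _) h hs

theorem mem_roumieuEll_real {s : ℝ} (hs0 : 0 < s) (hs : s < 1 / 2) (hs' : 0 ≤ s) {d : ℕ} {p : ℝ≥0∞}
    (hp : 1 ≤ p) {c : (Fin d → ℕ) → ℂ} {A ε : ℝ} (hε : 0 < ε)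
    (h : ∀ α, ‖c α‖ ≤ A * ∏ j, Real.exp (-ε * (α j : ℝ) ^ (1 / (2 * s)))) :
    c ∈ roumieuEll d p (.real s hs') := by
  set γ := 1 / (2 * s) with hγd
  have hγ : 1 ≤ γ := by rw [hγd, le_div_iff₀ (by linarith)]; linarith
  -- The power mean inequality gives |α|^γ ≤ D ∑ α_j^γ; the added 1 keeps D positive for d = 0. With
  -- r = ε/(2D) the weight uses half of the decay, and the other half is a summable geometric
  -- factor.
  set D : ℝ := (d : ℝ) ^ (γ - 1) + 1 with hD
  have hD0 : 0 < D := by positivity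
  refine Or.inr ⟨fun e => ?_, ε / (2 * D), by positivity, ?_⟩
  · injection e with e; linarith
  refine memℓp_of_norm_le_geometric (A := A) (q := Real.exp (-(ε / 2))) hp (Real.exp_pos _).le
    (Real.exp_lt_one_iff.mpr (by linarith)) fun α => ?_
  have hA : 0 ≤ A := by
    have := (norm_nonneg _).trans (h α)
    exact nonneg_of_mul_nonneg_left this (Finset.prod_pos fun j _ => Real.exp_pos _)
  simp only [seqWeight]
  rw [norm_mul, Complex.norm_real, Real.norm_of_nonneg (Real.exp_pos _).le]
  refine (mul_le_mul_of_nonneg_right (h α) (Real.exp_pos _).le).trans ?_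
  simp only [← Real.exp_nat_mul]
  rw [← Real.exp_sum, ← Real.exp_sum, mul_assoc, ← Real.exp_add]
  refine mul_le_mul_of_nonneg_left (Real.exp_le_exp.mpr ?_) hA
  have h1 : (multiLength α : ℝ) ^ γ ≤ D * ∑ j, (α j : ℝ) ^ γ := by
    have := Real.rpow_sum_le_const_mul_sum_rpow_of_nonneg (s := Finset.univ)
      (f := fun j => (α j : ℝ)) hγ fun j _ => Nat.cast_nonneg _
    rw [Finset.card_univ, Fintype.card_fin] at this
    rw [multiLength]
    push_cast
    refine this.trans (mul_le_mul_of_nonneg_right (by rw [hD]; linarith) ?_)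
    exact Finset.sum_nonneg fun j _ => by positivity
  have h2 : ∑ j, (α j : ℝ) ≤ ∑ j, (α j : ℝ) ^ γ := by
    refine Finset.sum_le_sum fun j _ => ?_
    rcases Nat.eq_zero_or_pos (α j) with h0 | h0
    · rw [h0]; simp [Real.zero_rpow (by linarith : γ ≠ 0)]
    · exact Real.self_le_rpow_of_one_le (by exact_mod_cast h0) hγ
  have h3 : ε / (2 * D) * (multiLength α : ℝ) ^ γ ≤ ε / 2 * ∑ j, (α j : ℝ) ^ γ := by
    refine (mul_le_mul_of_nonneg_left h1 (by positivity)).trans (le_of_eq ?_)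
    field_simp
  rw [← Finset.mul_sum, ← Finset.sum_mul]
  nlinarith

theorem mem_roumieuEll_flat {σ : ℝ} (hσ : 0 < σ) {d : ℕ} {p : ℝ≥0∞} (hp : 1 ≤ p)
    {c : (Fin d → ℕ) → ℂ} {A K : ℝ} (hK : 0 < K)
    (h : ∀ α, ‖c α‖ ≤ A * ∏ j, (K ^ α j * ((α j).factorial : ℝ) ^ (-(1 / (2 * σ))))) :
    c ∈ roumieuEll d p (.flat σ hσ) := by
  refine Or.inr ⟨nofun, 1 / (2 * K), by positivity, ?_⟩
  refine memℓp_of_norm_le_geometric (A := A) (q := 1 / 2) hp (by norm_num) (by norm_num) fun α => ?_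
  have hw : seqWeight (1 / (2 * K)) (.flat σ hσ) α =
      ∏ j, ((1 / (2 * K)) ^ α j * ((α j).factorial : ℝ) ^ (1 / (2 * σ))) := by
    simp only [seqWeight, multiLength, multiFactorial]
    rw [Finset.prod_mul_distrib, Finset.prod_pow_eq_pow_sum, Nat.cast_prod,
      ← Real.finsetProd_rpow _ _ fun j _ => by positivity]
  have hw0 : 0 ≤ ∏ j, ((1 / (2 * K)) ^ α j * ((α j).factorial : ℝ) ^ (1 / (2 * σ))) :=
    Finset.prod_nonneg fun j _ => by positivity
  rw [hw, norm_mul, Complex.norm_real, Real.norm_of_nonneg hw0]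
  refine (mul_le_mul_of_nonneg_right (h α) hw0).trans (le_of_eq ?_)
  rw [mul_assoc, ← Finset.prod_mul_distrib]
  congr 1
  refine Finset.prod_congr rfl fun j _ => ?_
  have hf : (0 : ℝ) < (α j).factorial := by positivity
  have h1 : ((α j).factorial : ℝ) ^ (1 / (2 * σ)) ≠ 0 := by positivity
  rw [Real.rpow_neg hf.le]
  simp only [div_pow, mul_pow, one_pow]
  field_simp

/-- A Liouville argument: here exp(r₁ V(R)) grows like R^{r₁}. If some α_i exceeds N ≥ r₁ + 1, keep
the other radii at 1 and let R_i → ∞; the coefficient vanishes. -/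
theorem mem_roumieuEll_zero {d : ℕ} {p : ℝ≥0∞} {c : (Fin d → ℕ) → ℂ} {A r₁ : ℝ} (hr₁ : 0 ≤ r₁)
    (h : ∀ (α : Fin d → ℕ) (R : Fin d → ℝ), (∀ j, 1 ≤ R j) →
      ‖c α‖ ≤ A * ∏ j, (√(α j).factorial * Real.exp (r₁ * logBracket (R j)) / R j ^ α j)) :
    c ∈ roumieuEll d p (.real 0 le_rfl) := by
  refine Or.inl ⟨rfl, ?_⟩
  obtain ⟨N, hN⟩ := exists_nat_ge (r₁ + 1)
  refine (Set.finite_Iic (fun _ : Fin d => N)).subset fun α hα => ?_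
  by_contra hcon
  obtain ⟨i, hi⟩ : ∃ i, N < α i := by
    by_contra hall
    push Not at hall
    exact hcon hall
  refine hα ?_
  set Q := ∏ j ∈ Finset.univ.erase i, (√(α j).factorial * Real.exp (r₁ * logBracket 1)) with hQ
  set B := A * Q * (√(α i).factorial * Real.exp (r₁ * Real.log 2)) with hB
  have hQ0 : 0 < Q := Finset.prod_pos fun j _ => by positivity
  have hA : 0 ≤ A := by
    have := (norm_nonneg _).trans (h α (fun _ => 1) fun _ => le_rfl)
    exact nonneg_of_mul_nonneg_left this (Finset.prod_pos fun j _ => by positivity)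
  have hle : ∀ R : ℝ, 1 ≤ R → ‖c α‖ ≤ B * R⁻¹ := by
    intro R hR
    have hR0 : 0 < R := by linarith
    have := h α (Function.update (fun _ => 1) i R) fun j => by
      rcases eq_or_ne j i with rfl | hj
      · simpa using hR
      · simp [hj]
    refine this.trans ?_
    rw [← Finset.mul_prod_erase _ _ (Finset.mem_univ i)]
    have e : ∏ j ∈ Finset.univ.erase i, (√(α j).factorial *
        Real.exp (r₁ * logBracket (Function.update (fun _ => (1 : ℝ)) i R j)) /
          Function.update (fun _ => (1 : ℝ)) i R j ^ α j) = Q := by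
      refine Finset.prod_congr rfl fun j hj => ?_
      rw [Function.update_of_ne (Finset.ne_of_mem_erase hj)]
      simp
    rw [e, Function.update_self, hB, mul_comm _ Q, mul_assoc, mul_assoc, mul_assoc]
    refine mul_le_mul_of_nonneg_left (mul_le_mul_of_nonneg_left ?_ hQ0.le) hA
    rw [mul_div_assoc]
    refine mul_le_mul_of_nonneg_left ?_ (by positivity)
    have h1 : logBracket R ≤ Real.log 2 + Real.log R := by
      rw [logBracket, ← Real.log_mul (by norm_num) hR0.ne']
      refine Real.log_le_log (by positivity) (Real.sqrt_le_iff.mpr ⟨by positivity, by nlinarith⟩)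
    have h2 : R ^ α i = Real.exp (α i * Real.log R) := by
      rw [Real.exp_nat_mul, Real.exp_log hR0]
    have h3 : R⁻¹ = Real.exp (-Real.log R) := by rw [Real.exp_neg, Real.exp_log hR0]
    rw [h2, h3, ← Real.exp_sub, ← Real.exp_add, Real.exp_le_exp]
    have h4 : (N : ℝ) ≤ α i := by exact_mod_cast hi.le
    have h5 : 0 ≤ Real.log R := Real.log_nonneg hR
    nlinarith [mul_le_mul_of_nonneg_left h1 hr₁]
  have hlim : Filter.Tendsto (fun R : ℝ => B * R⁻¹) Filter.atTop (nhds (B * 0)) :=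
    tendsto_inv_atTop_zero.const_mul B
  rw [mul_zero] at hlim
  have := ge_of_tendsto hlim (Filter.eventually_atTop.mpr ⟨1, hle⟩)
  exact norm_le_zero_iff.mp this

/-! ### Damping sequences for the Hermite functions. -/

/-- Sequences `b` that damp the growth of the Hermite functions to the growth `V`. -/
def Damps (b : ℕ → ℝ) (V : ℝ → ℝ) : Prop :=
  (∀ n, 0 ≤ b n) ∧ ∀ C, 1 ≤ C → ∃ K r : ℝ, 0 ≤ K ∧ 0 ≤ r ∧ ∀ (n : ℕ) (x : ℝ), 0 ≤ x →
    b n * (C ^ n * (1 + x ^ n / √n.factorial)) ≤ K * Real.exp (r * V x)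

theorem max_one_le_exp_logBracket (x : ℝ) : max x 1 ≤ Real.exp (logBracket x) := by
  rw [logBracket, Real.exp_log (by positivity)]
  exact max_le (Real.le_sqrt_of_sq_le (by linarith)) (one_le_sqrt_bracket x)

theorem one_add_pow_div_le (n : ℕ) {x : ℝ} (hx : 0 ≤ x) :
    1 + x ^ n / √n.factorial ≤ 2 * (max x 1) ^ n := by
  have h1 : 1 ≤ (max x 1) ^ n := one_le_pow₀ (le_max_right _ _)
  have h2 : x ^ n ≤ (max x 1) ^ n := pow_le_pow_left₀ hx (le_max_left _ _) n
  have h3 : x ^ n / √n.factorial ≤ x ^ n := by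
    refine div_le_self (by positivity) ?_
    rw [Real.one_le_sqrt]; exact_mod_cast n.factorial_pos
  linarith

theorem damps_indicator (N : ℕ) :
    Damps (fun n => if n ≤ N then 1 else 0) fun x => logBracket x ^ (1 / (1 - 2 * (0 : ℝ))) := by
  refine ⟨fun n => by positivity, fun C hC => ⟨2 * C ^ N, N, by positivity, by positivity,
    fun n x hx => ?_⟩⟩
  simp only [mul_zero, sub_zero, div_one, Real.rpow_one]
  split_ifs with hn
  · have h1 : (max x 1) ^ n ≤ Real.exp (N * logBracket x) := by
      rw [Real.exp_nat_mul]
      calc (max x 1) ^ n ≤ (max x 1) ^ N := pow_le_pow_right₀ (le_max_right _ _) hn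
        _ ≤ _ := pow_le_pow_left₀ (by positivity) (max_one_le_exp_logBracket x) N
    have h2 := pow_le_pow_right₀ hC hn
    calc _ = C ^ n * (1 + x ^ n / √n.factorial) := one_mul _
      _ ≤ C ^ N * (2 * Real.exp (N * logBracket x)) := by
        gcongr
        exact (one_add_pow_div_le n hx).trans (by gcongr)
      _ = _ := by ring
  · rw [zero_mul]; positivity

/-- Young's inequality for the conjugate exponents p and γ: n (log C + log⟨x⟩) is at most ε n^p plus
a multiple of 1 + (log⟨x⟩)^γ. -/
theorem damps_exp {s : ℝ} (hs0 : 0 < s) (hs : s < 1 / 2) {ε : ℝ} (hε : 0 < ε) :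
    Damps (fun n => Real.exp (-ε * (n : ℝ) ^ (1 / (2 * s))))
      fun x => logBracket x ^ (1 / (1 - 2 * s)) := by
  set γ := 1 / (1 - 2 * s) with hγd
  set p := 1 / (2 * s) with hpd
  have h12 : 0 < 1 - 2 * s := by linarith
  have hγ : 1 < γ := by rw [hγd, lt_div_iff₀ h12]; linarith
  have hp : 1 < p := by rw [hpd, lt_div_iff₀ (by linarith)]; linarith
  have hpq : p.HolderConjugate γ := by
    rw [Real.holderConjugate_iff]
    refine ⟨hp, ?_⟩
    rw [hγd, hpd]; simp
  refine ⟨fun n => (Real.exp_pos _).le, fun C hC => ?_⟩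
  set e := ε ^ (1 / p) with he
  have he0 : 0 < e := by positivity
  have hep : e ^ p = ε := by
    rw [he, ← Real.rpow_mul hε.le, one_div_mul_cancel (by linarith), Real.rpow_one]
  have hc : 1 ≤ Real.log C + 1 := by linarith [Real.log_nonneg hC]
  set K := (e⁻¹ * (Real.log C + 1)) ^ γ * 2 ^ γ with hK
  have hK0 : 0 ≤ K := by positivity
  refine ⟨2 * Real.exp K, K, by positivity, hK0, fun n x hx => ?_⟩
  have hL := logBracket_nonneg x
  have hCpos : 0 < C := by linarith
  have hyoung : n * (Real.log C + logBracket x) ≤ ε * (n : ℝ) ^ p + K * (1 + logBracket x ^ γ) := by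
    have hl : 0 ≤ Real.log C + logBracket x := by linarith
    have h1 := Real.young_inequality_of_nonneg (a := e * n) (b := e⁻¹ * (Real.log C + logBracket x))
      (by positivity) (by positivity) hpq
    have h2 : e * n * (e⁻¹ * (Real.log C + logBracket x)) = n * (Real.log C + logBracket x) := by
      field_simp
    rw [h2] at h1
    refine h1.trans (add_le_add ?_ ?_)
    · rw [Real.mul_rpow he0.le (by positivity), hep]
      exact div_le_self (by positivity) hp.le
    · refine (div_le_self (by positivity) hγ.le).trans ?_
      calc (e⁻¹ * (Real.log C + logBracket x)) ^ γ
          ≤ ((e⁻¹ * (Real.log C + 1)) * (1 + logBracket x)) ^ γ := by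
            refine Real.rpow_le_rpow (by positivity) ?_ (by linarith)
            rw [mul_assoc]
            refine mul_le_mul_of_nonneg_left ?_ (by positivity)
            nlinarith [mul_nonneg (Real.log_nonneg hC) hL]
        _ = (e⁻¹ * (Real.log C + 1)) ^ γ * (1 + logBracket x) ^ γ :=
            Real.mul_rpow (by positivity) (by positivity)
        _ ≤ (e⁻¹ * (Real.log C + 1)) ^ γ * (2 ^ γ * (1 + logBracket x ^ γ)) :=
            mul_le_mul_of_nonneg_left (one_add_rpow_le hL (by linarith)) (by positivity)
        _ = _ := by rw [hK]; ring
  have h5 : C ^ n * (max x 1) ^ n ≤ Real.exp (n * (Real.log C + logBracket x)) := by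
    rw [Real.exp_nat_mul, Real.exp_add, Real.exp_log hCpos, mul_pow]
    gcongr
    exact max_one_le_exp_logBracket x
  calc _ ≤ Real.exp (-ε * (n : ℝ) ^ p) * (C ^ n * (2 * (max x 1) ^ n)) := by
        gcongr; exact one_add_pow_div_le n hx
    _ = 2 * (Real.exp (-ε * (n : ℝ) ^ p) * (C ^ n * (max x 1) ^ n)) := by ring
    _ ≤ 2 * (Real.exp (-ε * (n : ℝ) ^ p) * Real.exp (n * (Real.log C + logBracket x))) := by gcongr
    _ ≤ 2 * Real.exp (K + K * logBracket x ^ γ) := by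
      rw [← Real.exp_add]
      refine mul_le_mul_of_nonneg_left (Real.exp_le_exp.mpr ?_) (by norm_num)
      linarith
    _ = _ := by rw [Real.exp_add]; ring

/-- The bound (y^q)^n / n! ≤ exp(y^q), raised to the power 1/q. -/
theorem pow_div_factorial_rpow_le {q y : ℝ} (hq : 0 < q) (hy : 0 ≤ y) (n : ℕ) :
    y ^ n / (n.factorial : ℝ) ^ (1 / q) ≤ Real.exp (y ^ q / q) := by
  have h := Real.pow_div_factorial_le_exp (x := y ^ q) (by positivity) n
  have h1 := Real.rpow_le_rpow (by positivity) h (by positivity : 0 ≤ 1 / q)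
  rw [Real.div_rpow (by positivity) (by positivity), ← Real.exp_mul, ← Real.rpow_natCast,
    ← Real.rpow_mul hy, ← Real.rpow_mul hy, mul_one_div, mul_div_right_comm,
    div_self hq.ne', one_mul, Real.rpow_natCast, mul_one_div] at h1
  exact h1

/-- Since 1/ρ = 1/(2σ) + 1/2, the factor n!^{-1/(2σ)} and the 1/√n! of the Hermite bound combine to
n!^{-1/ρ}, whose growth in x is exactly exp of a multiple of x^ρ. -/
theorem damps_factorial {σ : ℝ} (hσ : 0 < σ) {L : ℝ} (hL : 0 < L) :
    Damps (fun n => L ^ n * (n.factorial : ℝ) ^ (-(1 / (2 * σ))))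
      fun x => x ^ (2 * σ / (σ + 1)) := by
  set ρ := 2 * σ / (σ + 1) with hρ
  have hρ0 : 0 < ρ := by positivity
  have hρi : 1 / ρ = 1 / (2 * σ) + 1 / 2 := by rw [hρ]; field_simp; ring
  refine ⟨fun n => by positivity, fun C hC => ?_⟩
  have hC0 : 0 < C := by linarith
  refine ⟨Real.exp ((L * C) ^ (2 * σ) / (2 * σ)) + 1, (L * C) ^ ρ / ρ, by positivity, by positivity,
    fun n x hx => ?_⟩
  have hf : (0 : ℝ) < n.factorial := by positivity
  have h1 := pow_div_factorial_rpow_le (q := 2 * σ) (y := L * C) (by positivity) (by positivity) n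
  have h2 := pow_div_factorial_rpow_le (q := ρ) (y := L * C * x) hρ0 (by positivity) n
  rw [hρi, Real.rpow_add hf, ← Real.sqrt_eq_rpow, Real.mul_rpow (by positivity) hx] at h2
  have h3 : 1 ≤ Real.exp ((L * C) ^ ρ / ρ * x ^ ρ) := Real.one_le_exp (by positivity)
  have e4 : (L * C) ^ ρ / ρ * x ^ ρ = (L * C) ^ ρ * x ^ ρ / ρ := by ring
  have hs : √(n.factorial : ℝ) ≠ 0 := by positivity
  have hs2 : (n.factorial : ℝ) ^ (1 / (2 * σ)) ≠ 0 := by positivity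
  calc _ = (L * C) ^ n / (n.factorial : ℝ) ^ (1 / (2 * σ)) +
        (L * C * x) ^ n / ((n.factorial : ℝ) ^ (1 / (2 * σ)) * √n.factorial) := by
        beta_reduce
        rw [Real.rpow_neg hf.le, mul_pow, mul_pow, mul_pow]; field_simp
    _ ≤ Real.exp ((L * C) ^ (2 * σ) / (2 * σ)) * Real.exp ((L * C) ^ ρ / ρ * x ^ ρ) +
        Real.exp ((L * C) ^ ρ / ρ * x ^ ρ) := by
        refine add_le_add (h1.trans (le_mul_of_one_le_right (Real.exp_pos _).le h3)) ?_
        rw [e4]; exact h2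
    _ = _ := by ring

/-! ### Elements of the sequence spaces are damped. -/

theorem exists_norm_le_of_memℓp {ι : Type*} {p : ℝ≥0∞} {c : ι → ℂ} (h : Memℓp c p) :
    ∃ M, 0 ≤ M ∧ ∀ i, ‖c i‖ ≤ M := by
  obtain ⟨M, hM⟩ := (h.of_exponent_ge (p := ∞) le_top).bddAbove
  exact ⟨max M 0, le_max_right _ _, fun i => (hM ⟨i, rfl⟩).trans (le_max_left _ _)⟩

theorem exists_damps_of_mem_zero {d : ℕ} {p : ℝ≥0∞} {c : (Fin d → ℕ) → ℂ}
    (hc : c ∈ roumieuEll d p (.real 0 le_rfl)) :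
    ∃ b M, 0 ≤ M ∧ Damps b (fun x => logBracket x ^ (1 / (1 - 2 * (0 : ℝ)))) ∧
      ∀ α, ‖c α‖ ≤ M * ∏ j, b (α j) := by
  rcases hc with ⟨-, hfin⟩ | ⟨hne, -⟩
  · obtain ⟨N, hN⟩ := hfin.bddAbove
    have hM : 0 ≤ ∑ α ∈ hfin.toFinset, ‖c α‖ := Finset.sum_nonneg fun _ _ => norm_nonneg _
    refine ⟨_, ∑ α ∈ hfin.toFinset, ‖c α‖, hM, damps_indicator (∑ j, N j), fun α => ?_⟩
    by_cases hα : c α = 0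
    · rw [hα, norm_zero]
      exact mul_nonneg hM (Finset.prod_nonneg fun j _ => by positivity)
    · have h1 : ∏ j, (if α j ≤ ∑ j, N j then (1 : ℝ) else 0) = 1 :=
        Finset.prod_eq_one fun j _ => if_pos ((hN hα j).trans
          (Finset.single_le_sum (fun i _ => Nat.zero_le _) (Finset.mem_univ j)))
      rw [h1, mul_one]
      exact Finset.single_le_sum (f := fun α => ‖c α‖) (fun _ _ => norm_nonneg _)
        (hfin.mem_toFinset.mpr hα)
  · exact absurd rfl hne

theorem exists_damps_of_mem_real {s : ℝ} (hs0 : 0 < s) (hs : s < 1 / 2) (hs' : 0 ≤ s) {d : ℕ}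
    {p : ℝ≥0∞} {c : (Fin d → ℕ) → ℂ} (hc : c ∈ roumieuEll d p (.real s hs')) :
    ∃ b M, 0 ≤ M ∧ Damps b (fun x => logBracket x ^ (1 / (1 - 2 * s))) ∧
      ∀ α, ‖c α‖ ≤ M * ∏ j, b (α j) := by
  rcases hc with ⟨h, -⟩ | ⟨-, r, hr, hmem⟩
  · injection h with h; exact absurd h hs0.ne'
  obtain ⟨M, hM, h⟩ := exists_norm_le_of_memℓp hmem
  -- Each α_j is at most |α|, so splitting the weight over the coordinates costs a factor d; d + 1
  -- avoids dividing by zero.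
  refine ⟨_, M, hM, damps_exp hs0 hs (by positivity : 0 < r / (d + 1)), fun α => ?_⟩
  have h1 := h α
  simp only [seqWeight] at h1
  rw [norm_mul, Complex.norm_real, Real.norm_of_nonneg (Real.exp_pos _).le,
    ← le_div_iff₀ (Real.exp_pos _)] at h1
  refine h1.trans ?_
  rw [div_eq_mul_inv, ← Real.exp_neg, ← Real.exp_sum, ← Finset.mul_sum]
  refine mul_le_mul_of_nonneg_left (Real.exp_le_exp.mpr ?_) hM
  have h2 : ∑ j, (α j : ℝ) ^ (1 / (2 * s)) ≤ (d + 1) * (multiLength α : ℝ) ^ (1 / (2 * s)) := by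
    calc ∑ j, (α j : ℝ) ^ (1 / (2 * s)) ≤ ∑ _j : Fin d, (multiLength α : ℝ) ^ (1 / (2 * s)) := by
          refine Finset.sum_le_sum fun j _ => Real.rpow_le_rpow (by positivity) ?_ (by positivity)
          exact_mod_cast Finset.single_le_sum (f := α) (fun i _ => Nat.zero_le _) (Finset.mem_univ j)
      _ = d * (multiLength α : ℝ) ^ (1 / (2 * s)) := by simp
      _ ≤ _ := by gcongr; linarith
  have h3 : r / (d + 1) * ∑ j, (α j : ℝ) ^ (1 / (2 * s)) ≤
      r * (multiLength α : ℝ) ^ (1 / (2 * s)) := by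
    refine (mul_le_mul_of_nonneg_left h2 (by positivity)).trans (le_of_eq ?_)
    field_simp
  linarith

theorem exists_damps_of_mem_flat {σ : ℝ} (hσ : 0 < σ) {d : ℕ} {p : ℝ≥0∞} {c : (Fin d → ℕ) → ℂ}
    (hc : c ∈ roumieuEll d p (.flat σ hσ)) :
    ∃ b M, 0 ≤ M ∧ Damps b (fun x => x ^ (2 * σ / (σ + 1))) ∧ ∀ α, ‖c α‖ ≤ M * ∏ j, b (α j) := by
  rcases hc with ⟨h, -⟩ | ⟨-, r, hr, hmem⟩
  · cases h
  obtain ⟨M, hM, h⟩ := exists_norm_le_of_memℓp hmem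
  refine ⟨_, M, hM, damps_factorial hσ (by positivity : 0 < r⁻¹), fun α => ?_⟩
  have h1 := h α
  have hw : seqWeight r (.flat σ hσ) α =
      ∏ j, (r ^ α j * ((α j).factorial : ℝ) ^ (1 / (2 * σ))) := by
    simp only [seqWeight, multiLength, multiFactorial]
    rw [Finset.prod_mul_distrib, Finset.prod_pow_eq_pow_sum, Nat.cast_prod,
      ← Real.finsetProd_rpow _ _ fun j _ => by positivity]
  have hw0 : 0 < ∏ j, (r ^ α j * ((α j).factorial : ℝ) ^ (1 / (2 * σ))) :=
    Finset.prod_pos fun j _ => by positivity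
  rw [norm_mul, hw, Complex.norm_real, Real.norm_of_nonneg hw0.le, ← le_div_iff₀ hw0] at h1
  refine h1.trans (le_of_eq ?_)
  rw [div_eq_mul_inv, ← Finset.prod_inv_distrib]
  congr 1
  refine Finset.prod_congr rfl fun j _ => ?_
  rw [mul_inv, inv_pow, Real.rpow_neg (by positivity)]

/-! ### Summing Hermite series to functions. -/

/-- A Hermite series dominated by a square integrable product times a geometric sequence
represents a function. -/
theorem exists_represents_of_term_le {φ : ℝ → ℝ} (hφ0 : ∀ y, 0 ≤ φ y) (hφc : Continuous φ) {T : ℝ}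
    (hφT : ∀ y, φ y ≤ T) (hφi : Integrable fun y => φ y * φ y) {d : ℕ} {M : ℝ} (hM : 0 ≤ M)
    (f : FormalHermite d)
    (hle : ∀ (α : Fin d → ℕ) (x : EuclideanSpace ℝ (Fin d)),
      ‖f.coeff α * (hermiteFunMulti α x : ℂ)‖ ≤ M * (∏ j, φ (x j)) * ∏ j, (1 / 2 : ℝ) ^ α j) :
    ∃ g, f.Represents g ∧ ∀ x, ‖g x‖ ≤ M * (∏ j, φ (x j)) * 2 ^ d := by
  have hgeo : HasSum (fun α : Fin d → ℕ => ∏ j, (1 / 2 : ℝ) ^ α j) (2 ^ d) := by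
    have := (summable_norm_pi_prod_and_hasSum (fun (_ : Fin d) n => (1 / 2 : ℝ) ^ n)
      fun _ => summable_geometric_two.norm).2
    rw [tsum_geometric_two, Finset.prod_const, Finset.card_univ, Fintype.card_fin] at this
    exact this
  obtain ⟨Φ, hΦ⟩ : ∃ Φ : EuclideanSpace ℝ (Fin d) → ℝ, ∀ x, ∏ j, φ (x j) = Φ x :=
    ⟨_, fun _ => rfl⟩
  have hΦ0 : ∀ x, 0 ≤ Φ x := fun x => hΦ x ▸ Finset.prod_nonneg fun j _ => hφ0 _
  have hΦc : Continuous Φ := by simp only [← funext hΦ]; fun_prop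
  have hΦT : ∀ x, Φ x ≤ T ^ d := by
    intro x
    rw [← hΦ]
    calc ∏ j, φ (x j) ≤ ∏ _j : Fin d, T :=
          Finset.prod_le_prod (fun j _ => hφ0 _) fun j _ => hφT _
      _ = T ^ d := by simp
  have hΦ2 : Integrable fun x => Φ x * Φ x := by
    simp only [← hΦ, ← Finset.prod_mul_distrib]
    exact integrable_euclidean_prod (f := fun _ y => φ y * φ y) fun j => hφi
  simp only [hΦ] at hle ⊢
  obtain ⟨g, hg⟩ : ∃ g : EuclideanSpace ℝ (Fin d) → ℂ,
      ∀ x, ∑' α, f.coeff α * (hermiteFunMulti α x : ℂ) = g x := ⟨_, fun _ => rfl⟩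
  have hgΦ : ∀ x, ‖g x‖ ≤ M * Φ x * 2 ^ d := fun x =>
    hg x ▸ tsum_of_norm_bounded (hgeo.mul_left _) fun α => hle α x
  have hsum : ∀ x, HasSum (fun α => f.coeff α * (hermiteFunMulti α x : ℂ)) (g x) := fun x =>
    hg x ▸ (Summable.of_norm_bounded (hgeo.summable.mul_left _) fun α => hle α x).hasSum
  have hgc : Continuous g := by
    rw [← funext hg]
    have hc : ∀ α : Fin d → ℕ, Continuous fun x : EuclideanSpace ℝ (Fin d) =>
        f.coeff α * (hermiteFunMulti α x : ℂ) := fun α =>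
      continuous_const.mul (Complex.continuous_ofReal.comp (continuous_hermiteFunMulti α))
    have hu : Summable fun α : Fin d → ℕ => M * T ^ d * ∏ j, (1 / 2 : ℝ) ^ α j :=
      hgeo.summable.mul_left (M * T ^ d)
    exact continuous_tsum hc hu fun α x => (hle α x).trans
      (mul_le_mul_of_nonneg_right (mul_le_mul_of_nonneg_left (hΦT x) hM)
        (Finset.prod_nonneg fun j _ => by positivity))
  have hL2 : MemLp g 2 volume := by
    rw [memLp_two_iff_integrable_sq_norm hgc.aestronglyMeasurable]
    refine (hΦ2.const_mul ((M * 2 ^ d) ^ 2)).mono' (hgc.norm.pow 2).aestronglyMeasurable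
      (Filter.Eventually.of_forall fun x => ?_)
    rw [Real.norm_of_nonneg (by positivity)]
    calc ‖g x‖ ^ 2 ≤ (M * Φ x * 2 ^ d) ^ 2 := pow_le_pow_left₀ (norm_nonneg _) (hgΦ x) 2
      _ = _ := by ring
  refine ⟨g, ⟨hL2, fun β => ?_⟩, hgΦ⟩
  have hΦh : Integrable fun x => Φ x * |hermiteFunMulti β x| := by
    refine (hΦ2.add (integrable_hermiteFunMulti_mul β β)).mono'
      (hΦc.mul (continuous_hermiteFunMulti β).abs).aestronglyMeasurable
      (Filter.Eventually.of_forall fun x => ?_)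
    rw [Real.norm_of_nonneg (mul_nonneg (hΦ0 x) (abs_nonneg _))]
    simp only [Pi.add_apply]
    nlinarith [sq_nonneg (Φ x - |hermiteFunMulti β x|), abs_mul_abs_self (hermiteFunMulti β x),
      mul_self_nonneg (Φ x), mul_self_nonneg (hermiteFunMulti β x)]
  -- Integrating the series against h_β term by term, orthonormality leaves only the coefficient of
  -- index β.
  have hint := hasSum_integral_of_dominated_convergence (μ := volume)
    (F := fun α x => f.coeff α * (hermiteFunMulti α x : ℂ) * (hermiteFunMulti β x : ℂ))
    (f := fun x => g x * (hermiteFunMulti β x : ℂ))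
    (fun α x => M * (Φ x * |hermiteFunMulti β x|) * ∏ j, (1 / 2 : ℝ) ^ α j)
    (fun α => ?_) (fun α => Filter.Eventually.of_forall fun x => ?_)
    (Filter.Eventually.of_forall fun x =>
      hgeo.summable.mul_left (M * (Φ x * |hermiteFunMulti β x|))) ?_
    (Filter.Eventually.of_forall fun x => (hsum x).mul_right _)
  · have hval : ∀ α, ∫ x, f.coeff α * (hermiteFunMulti α x : ℂ) * (hermiteFunMulti β x : ℂ) =
        if α = β then f.coeff β else 0 := by
      intro α
      have : ∀ x : EuclideanSpace ℝ (Fin d),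
          f.coeff α * (hermiteFunMulti α x : ℂ) * (hermiteFunMulti β x : ℂ) =
          f.coeff α * ((hermiteFunMulti α x * hermiteFunMulti β x : ℝ) : ℂ) := fun x => by
        push_cast; ring
      simp_rw [this]
      rw [integral_const_mul, integral_complex_ofReal, integral_hermiteFunMulti_mul]
      split_ifs with h <;> simp [h]
    simp_rw [hval] at hint
    exact (hasSum_ite_eq β (f.coeff β)).unique hint
  · exact ((continuous_const.mul (Complex.continuous_ofReal.comp
      (continuous_hermiteFunMulti α))).mul (Complex.continuous_ofReal.comp
      (continuous_hermiteFunMulti β))).aestronglyMeasurable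
  · rw [norm_mul, Complex.norm_real, Real.norm_eq_abs]
    calc _ ≤ M * Φ x * (∏ j, (1 / 2 : ℝ) ^ α j) * |hermiteFunMulti β x| :=
          mul_le_mul_of_nonneg_right (hle α x) (abs_nonneg _)
      _ = _ := by ring
  · simp_rw [tsum_mul_left, hgeo.tsum_eq]
    exact (hΦh.const_mul M).mul_const _

/-- Damping is used with C = 2e³: e^{3n} absorbs the factor in the Hermite bound and 2^n buys the
geometric decay that makes the series summable. -/
theorem Damps.hermiteFun_le {V : ℝ → ℝ} {b : ℕ → ℝ} (hb : Damps b V) :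
    ∃ K r : ℝ, 0 ≤ K ∧ 0 ≤ r ∧ ∀ (n : ℕ) (y : ℝ), b n * |hermiteFun n y| ≤
      K * Real.exp (-(y ^ 2 / 2) + r * V |y|) * (1 / 2) ^ n := by
  obtain ⟨hb0, hbC⟩ := hb
  obtain ⟨K, r, hK, hr, hKr⟩ := hbC (2 * Real.exp 3)
    (by linarith [Real.one_le_exp (by norm_num : (0 : ℝ) ≤ 3)])
  refine ⟨K, r, hK, hr, fun n y => ?_⟩
  have h1 := hKr n |y| (abs_nonneg y)
  have h3 : (2 : ℝ) ^ n * (1 / 2) ^ n = 1 := by rw [← mul_pow]; norm_num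
  calc b n * |hermiteFun n y| ≤ b n * (Real.exp (-(y ^ 2 / 2)) *
        ((Real.exp 3) ^ n * (1 + |y| ^ n / √n.factorial))) :=
        mul_le_mul_of_nonneg_left (abs_hermiteFun_le_pow n y) (hb0 n)
    _ = Real.exp (-(y ^ 2 / 2)) * (b n * ((2 * Real.exp 3) ^ n * (1 + |y| ^ n / √n.factorial))) *
        (1 / 2) ^ n := by
        rw [mul_pow]
        linear_combination (-(b n * (Real.exp (-(y ^ 2 / 2)) *
          ((Real.exp 3) ^ n * (1 + |y| ^ n / √n.factorial))))) * h3
    _ ≤ Real.exp (-(y ^ 2 / 2)) * (K * Real.exp (r * V |y|)) * (1 / 2) ^ n := by gcongr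
    _ = _ := by rw [Real.exp_add]; ring

/-- Monotonicity bounds each V(|x_j|) by V(‖x‖). The extra 1 makes the resulting exponent strictly
positive even when r d = 0. -/
theorem IsGrowth.prod_exp_le {V : ℝ → ℝ} (hV : IsGrowth V) {r : ℝ} (hr : 0 ≤ r) {d : ℕ}
    (x : EuclideanSpace ℝ (Fin d)) : ∏ j, Real.exp (-(x j ^ 2 / 2) + r * V |x j|) ≤
      Real.exp (-(‖x‖ ^ 2 / 2)) * Real.exp ((r * d + 1) * V ‖x‖) := by
  rw [← Real.exp_sum, ← Real.exp_add, Real.exp_le_exp, Finset.sum_add_distrib,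
    Finset.sum_neg_distrib, ← Finset.sum_div, ← Finset.mul_sum, EuclideanSpace.norm_sq_eq]
  simp only [Real.norm_eq_abs, sq_abs]
  have h1 : ∑ j, V |x j| ≤ ∑ _j : Fin d, V ‖x‖ :=
    Finset.sum_le_sum fun j _ => hV.mono (Set.mem_Ici.mpr (abs_nonneg _))
      (Set.mem_Ici.mpr (norm_nonneg _)) (by simpa using PiLp.norm_apply_le x j)
  rw [Finset.sum_const, Finset.card_univ, Fintype.card_fin, nsmul_eq_mul] at h1
  have h2 := mul_le_mul_of_nonneg_left h1 hr
  have h3 := hV.nonneg ‖x‖ (norm_nonneg x)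
  linarith

/-- Damped coefficients give functions in all partial fractional Fourier transforms, with a uniform
bound. -/
theorem IsGrowth.exists_represents_of_damps {V : ℝ → ℝ} (hV : IsGrowth V) {b : ℕ → ℝ}
    (hb : Damps b V) (d : ℕ) {M : ℝ} (hM : 0 ≤ M) :
    ∃ B r : ℝ, 0 < r ∧ ∀ f : FormalHermite d, (∀ α, ‖f.coeff α‖ ≤ M * ∏ j, b (α j)) →
      ∃ g, f.Represents g ∧ ∀ x, ‖g x‖ ≤ B * (Real.exp (-(‖x‖ ^ 2 / 2)) * Real.exp (r * V ‖x‖)) := by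
  obtain ⟨K, r, hK, hr, hterm⟩ := hb.hermiteFun_le
  obtain ⟨φ, hφ⟩ : ∃ φ : ℝ → ℝ, ∀ y, K * Real.exp (-(y ^ 2 / 2) + r * V |y|) = φ y :=
    ⟨_, fun _ => rfl⟩
  have hφ0 : ∀ y, 0 ≤ φ y := fun y => by rw [← hφ]; positivity
  obtain ⟨T, hφT⟩ : ∃ T, ∀ y, φ y ≤ T := by
    obtain ⟨C, hC, h⟩ := hV.subquad (1 / (2 * (r + 1))) (by positivity)
    refine ⟨K * Real.exp (r * C), fun y => ?_⟩
    rw [← hφ]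
    refine mul_le_mul_of_nonneg_left (Real.exp_le_exp.mpr ?_) hK
    have h1 := mul_le_mul_of_nonneg_left (h |y| (abs_nonneg y)) hr
    rw [sq_abs] at h1
    have h2 : r * (1 / (2 * (r + 1))) ≤ 1 / 2 := by
      rw [mul_one_div, div_le_div_iff₀ (by positivity) (by norm_num)]; linarith
    nlinarith [mul_le_mul_of_nonneg_right h2 (sq_nonneg y)]
  have hφc : Continuous φ := by
    obtain ⟨W, hW, hWV⟩ : ∃ W : ℝ → ℝ, Continuous W ∧ ∀ y, V |y| = W y :=
      ⟨_, hV.cont, fun _ => rfl⟩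
    simp only [← funext hφ, hWV]
    fun_prop
  have hφi : Integrable fun y => φ y * φ y := by
    refine ((hV.integrable_gauss (r := 2 * r) (by positivity) 0).const_mul (K ^ 2)).congr
      (Filter.Eventually.of_forall fun y => ?_)
    simp only [← hφ]
    rw [mul_mul_mul_comm, ← Real.exp_add]
    ring_nf
  simp only [hφ] at hterm
  refine ⟨M * K ^ d * 2 ^ d, r * d + 1, by positivity, fun f hf => ?_⟩
  obtain ⟨g, hg, hgb⟩ := exists_represents_of_term_le hφ0 hφc hφT hφi hM f fun α x => by
    rw [norm_mul, Complex.norm_real, hermiteFunMulti, norm_prod]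
    calc _ ≤ M * (∏ j, b (α j)) * ∏ j, ‖hermiteFun (α j) (x j)‖ :=
          mul_le_mul_of_nonneg_right (hf α) (Finset.prod_nonneg fun j _ => norm_nonneg _)
      _ = M * ∏ j, (b (α j) * |hermiteFun (α j) (x j)|) := by
          rw [Finset.prod_mul_distrib, mul_assoc]; rfl
      _ ≤ M * ∏ j, (φ (x j) * (1 / 2) ^ α j) :=
          mul_le_mul_of_nonneg_left (Finset.prod_le_prod
            (fun j _ => mul_nonneg (hb.1 _) (abs_nonneg _)) fun j _ => hterm _ _) hM
      _ = _ := by rw [Finset.prod_mul_distrib, ← mul_assoc]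
  refine ⟨g, hg, fun x => (hgb x).trans ?_⟩
  simp only [← hφ]
  rw [Finset.prod_mul_distrib, Finset.prod_const, Finset.card_univ, Fintype.card_fin]
  calc _ = M * K ^ d * 2 ^ d * ∏ j, Real.exp (-(x j ^ 2 / 2) + r * V |x j|) := by ring
    _ ≤ _ := mul_le_mul_of_nonneg_left (hV.prod_exp_le hr x) (by positivity)

/-! ### Weighted sup norms and the equivalence. -/

theorem weightedSupNorm_le_of_represents {d : ℕ} {f : FormalHermite d} {B r : ℝ} {V : ℝ → ℝ}
    {g : EuclideanSpace ℝ (Fin d) → ℂ} (hg : f.Represents g)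
    (h : ∀ x, ‖g x‖ ≤ B * (Real.exp (-(‖x‖ ^ 2 / 2)) * Real.exp (r * V ‖x‖))) :
    f.weightedSupNorm (fun x => Real.exp (‖x‖ ^ 2 / 2) * Real.exp (-r * V ‖x‖)) ≤
      ENNReal.ofReal B := by
  refine iInf₂_le_of_le g hg ?_
  rw [eLpNorm_exponent_top]
  refine eLpNormEssSup_le_of_ae_bound (Filter.Eventually.of_forall fun x => ?_)
  rw [norm_mul, Complex.norm_real, Real.norm_of_nonneg (by positivity)]
  calc _ ≤ B * (Real.exp (-(‖x‖ ^ 2 / 2)) * Real.exp (r * V ‖x‖)) *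
        (Real.exp (‖x‖ ^ 2 / 2) * Real.exp (-r * V ‖x‖)) := by gcongr; exact h x
    _ = B * Real.exp (-(‖x‖ ^ 2 / 2) + r * V ‖x‖ + (‖x‖ ^ 2 / 2 + -r * V ‖x‖)) := by
      rw [Real.exp_add, Real.exp_add, Real.exp_add]; ring
    _ = B := by
      rw [show -(‖x‖ ^ 2 / 2) + r * V ‖x‖ + (‖x‖ ^ 2 / 2 + -r * V ‖x‖) = 0 by ring]; simp

/-- The strict inequality extracts a representing function from the infimum, so almost everywhere
uniqueness is not needed. -/
theorem exists_represents_of_weightedSupNorm_lt {d : ℕ} {f : FormalHermite d} {B r : ℝ}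
    {V : ℝ → ℝ}
    (h : f.weightedSupNorm (fun x => Real.exp (‖x‖ ^ 2 / 2) * Real.exp (-r * V ‖x‖)) <
      ENNReal.ofReal B) :
    ∃ g, f.Represents g ∧
      ∀ᵐ x, ‖g x‖ ≤ B * (Real.exp (-(‖x‖ ^ 2 / 2)) * Real.exp (r * V ‖x‖)) := by
  simp only [FormalHermite.weightedSupNorm, iInf_lt_iff] at h
  obtain ⟨g, hg, h⟩ := h
  refine ⟨g, hg, ?_⟩
  rw [eLpNorm_exponent_top] at h
  have hB : 0 < B := ENNReal.ofReal_pos.mp (bot_le.trans_lt h)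
  filter_upwards [ae_le_eLpNormEssSup (f := fun x => g x *
    ((Real.exp (‖x‖ ^ 2 / 2) * Real.exp (-r * V ‖x‖) : ℝ) : ℂ)) (μ := volume)] with x hx
  have h1 := hx.trans h.le
  rw [← ofReal_norm, ENNReal.ofReal_le_ofReal_iff hB.le, norm_mul, Complex.norm_real,
    Real.norm_of_nonneg (by positivity), ← Real.exp_add, ← le_div_iff₀ (Real.exp_pos _)] at h1
  refine h1.trans (le_of_eq ?_)
  rw [div_eq_mul_inv, ← Real.exp_neg, ← Real.exp_add]
  ring_nf

/-- The three conditions are equivalent as soon as the weight and the coefficient space are matched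
by a growth function. -/
theorem IsGrowth.tfae {V : ℝ → ℝ} (hV : IsGrowth V) {d : ℕ} {p : ℝ≥0∞} {s : PilIndex}
    (hω : ∀ r x, omegaWeight d r s x = Real.exp (-r * V ‖x‖))
    (hdamps : ∀ c ∈ roumieuEll d p s, ∃ b M, 0 ≤ M ∧ Damps b V ∧ ∀ α, ‖c α‖ ≤ M * ∏ j, b (α j))
    (hmem : ∀ (c : (Fin d → ℕ) → ℂ) (A r₁ : ℝ), 0 ≤ A → 0 ≤ r₁ →
      (∀ (α : Fin d → ℕ) (R : Fin d → ℝ), (∀ j, 1 ≤ R j) →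
        ‖c α‖ ≤ A * ∏ j, (√(α j).factorial * Real.exp (r₁ * V (R j)) / R j ^ α j)) →
      c ∈ roumieuEll d p s)
    (t₀ u : Fin d → ℝ) (hu : ∀ j, u j ∈ Set.Ioo (0 : ℝ) 1) (f : FormalHermite d) :
    List.TFAE
      [f ∈ pilipovicRoumieu d p s,
        ∃ r : ℝ, 0 < r ∧ (⨆ t ∈ latticeSet t₀ u, (f.fracFourier t).weightedSupNorm
          (fun x => Real.exp (‖x‖ ^ 2 / 2) * omegaWeight d r s x)) < ∞,
        ∃ r : ℝ, 0 < r ∧ (⨆ t : Fin d → ℝ, (f.fracFourier t).weightedSupNorm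
          (fun x => Real.exp (‖x‖ ^ 2 / 2) * omegaWeight d r s x)) < ∞] := by
  simp only [hω]
  tfae_have 1 → 3 := by
    rintro ⟨c, hc, rfl⟩
    obtain ⟨b, M, hM, hb, hcb⟩ := hdamps c hc
    obtain ⟨B, r, hr, h⟩ := hV.exists_represents_of_damps hb d hM
    refine ⟨r, hr, (iSup_le fun t => ?_).trans_lt (ENNReal.ofReal_lt_top (r := B))⟩
    obtain ⟨g, hg, hgB⟩ := h (FormalHermite.fracFourier t ⟨c⟩) fun α => by
      simp only [FormalHermite.fracFourier]
      rw [fracFourier_phase, norm_mul, norm_prod]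
      simpa [norm_ray] using hcb α
    exact weightedSupNorm_le_of_represents hg hgB
  tfae_have 3 → 2 := by
    rintro ⟨r, hr, h⟩
    exact ⟨r, hr, (iSup₂_le fun t _ => le_iSup (fun t : Fin d → ℝ =>
      (f.fracFourier t).weightedSupNorm _) t).trans_lt h⟩
  tfae_have 2 → 1 := by
    rintro ⟨r, hr, h⟩
    obtain ⟨S, hS⟩ := ENNReal.lt_iff_exists_real_btwn.mp h
    obtain ⟨A, r₁, hA, hr₁, hc⟩ := hV.exists_coeff_bound_of_lattice hr.le t₀ u hu f S fun t ht =>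
      exists_represents_of_weightedSupNorm_lt ((le_iSup₂ (f := fun t (_ : t ∈ latticeSet t₀ u) =>
        (f.fracFourier t).weightedSupNorm _) t ht).trans_lt hS.2.1)
    exact ⟨f.coeff, hmem _ A r₁ hA hr₁ hc, rfl⟩
  tfae_finish

end HermiteAux

open HermiteAux in
theorem theorem2p3 (d : ℕ) (p : ℝ≥0∞) (hp : 1 ≤ p) (s : PilIndex) (hs : s < PilIndex.half)
    (t₀ u : Fin d → ℝ) (hu : ∀ j, u j ∈ Set.Ioo (0 : ℝ) 1) (f : FormalHermite d) :
    List.TFAE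
      [f ∈ pilipovicRoumieu d p s,
        ∃ r : ℝ, 0 < r ∧ (⨆ t ∈ latticeSet t₀ u, (f.fracFourier t).weightedSupNorm
          (fun x => Real.exp (‖x‖ ^ 2 / 2) * omegaWeight d r s x)) < ∞,
        ∃ r : ℝ, 0 < r ∧ (⨆ t : Fin d → ℝ, (f.fracFourier t).weightedSupNorm
          (fun x => Real.exp (‖x‖ ^ 2 / 2) * omegaWeight d r s x)) < ∞] := by
  cases s with
  | real s hs0 =>
    have hs2 : s < 1 / 2 := hs
    have hγ : 1 ≤ 1 / (1 - 2 * s) := by rw [le_div_iff₀ (by linarith)]; linarith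
    refine (isGrowth_log hγ).tfae (fun r x => ?_) (fun c hc => ?_) (fun c A r₁ hA hr₁ hc => ?_)
      t₀ u hu f
    · simp only [omegaWeight, if_pos hs2, logBracket]
    · rcases hs0.eq_or_lt with rfl | h0
      · exact exists_damps_of_mem_zero hc
      · exact exists_damps_of_mem_real h0 hs2 hs0 hc
    · rcases hs0.eq_or_lt with rfl | h0
      -- At s = 0 the exponent 1/(1-2s) equals 1, so V is `logBracket` itself.
      · exact mem_roumieuEll_zero hr₁ (by simpa using hc)
      · obtain ⟨K, ε, hK, hε, hb⟩ := radiusBound_log h0 hs2 hr₁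
        refine mem_roumieuEll_real h0 hs2 hs0 hp (A := A * K ^ d) hε fun α => ?_
        refine (norm_le_of_radiusBound hb hA hc α).trans (le_of_eq ?_)
        rw [Finset.prod_mul_distrib, Finset.prod_const, Finset.card_univ, Fintype.card_fin,
          mul_assoc]
  | flat σ hσ =>
    have hρ : 2 * σ / (σ + 1) < 2 := by rw [div_lt_iff₀ (by linarith)]; linarith
    refine (isGrowth_rpow (by positivity) hρ).tfae (fun r x => rfl)
      (fun c hc => exists_damps_of_mem_flat hσ hc) (fun c A r₁ hA hr₁ hc => ?_) t₀ u hu f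
    refine mem_roumieuEll_flat hσ hp (A := A * Real.exp r₁ ^ d) (Real.exp_pos r₁) fun α => ?_
    refine (norm_le_of_radiusBound (radiusBound_rpow hσ r₁ hr₁) hA hc α).trans (le_of_eq ?_)
    rw [Finset.prod_mul_distrib, Finset.prod_const, Finset.card_univ, Fintype.card_fin, mul_assoc]

end
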